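/- \textbf{Covariant Stinespring theorem.} \emph{Conventions.} A C*-2-category is a (weak) 2-category with a dagger on 2-morphisms (for which associators and unitors are unitary) whose 2-morphism spaces are complex Banach spaces, with linear compositions, antilinear dagger, $\|f\circ g\|\le\|f\|\|g\|$, $\|f^\dagger f\|=\|f\|^2$, and $f^\dagger f$ positive in $\mathrm{End}(X)$ for $f:X\to Y$. It is \emph{presemisimple} if every Hom-category has a zero object, finite orthogonal direct sums, split dagger idempotents and finite-dimensional endomorphism algebras; every 1-morphism has a right dual; there are a zero object and finite direct sums of objects; and every object is a finite direct sum of objects $r_i$ with $\mathrm{End}(\mathrm{id}_{r_i})\cong\mathbb{C}$. For 1-morphisms $X:r\to s$, $Y:s\to t$ the composite is written $X\otimes Y:r\to t$. Let $\mathrm{Tr}_r$ be the trace on the finite-dimensional commutative C*-algebra $\mathrm{End}(\mathrm{id}_r)$ that sends every minimal projection to $1$. A right dual $[X^*:s\to r,\ \eta_X:\mathrm{id}_s\to X^*\otimes X,\ \epsilon_X:X\otimes X^*\to\mathrm{id}_r]$ of $X:r\to s$ is \emph{standard} if $\mathrm{Tr}_s[\eta_X^\dagger(\mathrm{id}_{X^*}\otimes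 T)\eta_X]=\mathrm{Tr}_r[\epsilon_X(T\otimes\mathrm{id}_{X^*})\epsilon_X^\dagger]$ for all $T\in\mathrm{End}(X)$. All duals below are standard. Put $\dim_L(X)=\eta_X^\dagger\eta_X\in\mathrm{End}(\mathrm{id}_s)$ and $d(X)=\mathrm{Tr}_s[\dim_L(X)]$ (the quantum dimension). $X$ is \emph{separable} if $\dim_L(X)$ is invertible, and then $n_X=\dim_L(X)^{1/2}$. A \emph{standard separable Frobenius algebra} (SSFA) in $\mathrm{End}(r)$ is an algebra $[A,m,u]$ which satisfies the Frobenius equation with respect to $m^\dagger$, satisfies $mm^\dagger=\mathrm{id}_A$, and for which the cup $m^\dagger u$ and cap $u^\dagger m$ form a standard duality. For separable $X:r\to s$ the pair of pants algebra is the SSFA $X\otimes X^*$ in $\mathrm{End}(r)$ with multiplication $m=\mathrm{id}_X\otimes(n_X^{-1}\eta_X^\dagger)\otimes\mathrm{id}_{X^*}$ and unit $u=(\mathrm{id}_X\otimes n_X\otimes\mathrm{id}_{X^*})\epsilon_X^\dagger$. A presemisimple C*-2-category is \emph{semisimple} if every SSFA in every $\mathrm{End}(r)$ is unitarily $*$-isomorphic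 to a pair of pants algebra $X\otimes X^*$ of a separable $X$ out of $r$. A morphism $f:A\to B$ of SSFAs is \emph{CP} if $(\mathrm{id}_A\otimes m_B)(\mathrm{id}_A\otimes f\otimes\mathrm{id}_B)(m_A^\dagger\otimes\mathrm{id}_B)=g^\dagger g$ for some object $S$ of $\mathrm{End}(r)$ and some $g:A\otimes B\to S$; a CP morphism is a \emph{channel} if $u_B^\dagger f=u_A^\dagger$. \emph{Theorem.} Let $r$ be an object of a semisimple C*-2-category and let $X:r\to s$, $Y:r\to t$ be separable 1-morphisms. For $E:t\to s$ and $\tau:X\to Y\otimes E$ let $\tau_*:X^*\to E^*\otimes Y^*$ be the right transpose of $\tau^\dagger$. Call $\tau$ a \emph{dilation} of $f:X\otimes X^*\to Y\otimes Y^*$, with environment $E$, if $$f=(\mathrm{id}_Y\otimes\epsilon_E\otimes\mathrm{id}_{Y^*})\circ(\tau\otimes\tau_*),\qquad(1)$$ and let $\hat\tau=(\mathrm{id}_Y\otimes n_Y^{1/2}\otimes\mathrm{id}_E)\circ\tau\circ(\mathrm{id}_X\otimes n_X^{-1/2})$ be the normalised $\tau$. \begin{enumerate} \item Every CP morphism $f:X\otimes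 X^*\to Y\otimes Y^*$ between the pair of pants SSFAs has a dilation. For any dilation $\tau$ of $f$, $\hat\tau$ is an isometry if and only if $f$ is a channel. \item Conversely, for every $E:t\to s$ and every $\tau:X\to Y\otimes E$, the morphism $f$ defined by (1) is CP, and it is a channel if and only if $\hat\tau$ is an isometry. \item If $\tau_1:X\to Y\otimes E_1$ and $\tau_2:X\to Y\otimes E_2$ are dilations of the same CP morphism, there is a partial isometry $\alpha:E_1\to E_2$ with $(\mathrm{id}_Y\otimes\alpha)\tau_1=\tau_2$ and $(\mathrm{id}_Y\otimes\alpha^\dagger)\tau_2=\tau_1$. \item Every CP morphism has a dilation which minimises $d(E)$ among all its dilations, and any two such minimal dilations are related as in (3) by a unitary $\alpha$. Concretely, if $\tau:X\to Y\otimes E$ is any dilation, $\tilde\tau=(\eta_Y^\dagger\otimes\mathrm{id}_E)(\mathrm{id}_{Y^*}\otimes\tau):Y^*\otimes X\to E$, and the isometry $i:\tilde E\to E$ splits the support projection of $|\tilde\tau^\dagger|$, then $(\mathrm{id}_Y\otimes i^\dagger)\tau$ is a minimal dilation. \end{enumerate} -/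

import Mathlib

open CategoryTheory Bicategory

universe w v u

noncomputable section

namespace CovStinespring

/-! Conventions. A 2-category is a Mathlib `Bicategory`. For `X : r ⟶ s` and `Y : s ⟶ t` the
horizontal composite `X ⊗ Y : r → t` is `X ≫ Y`, and the whiskerings `id_X ⊗ f` and `f ⊗ id_X`
are `X ◁ f` and `f ▷ X`. Vertical composition is written in diagrammatic order: `g ∘ f` is
`f ≫ g`. The composition `f ⊗≫ g` inserts the coherence isomorphism (built from associators and
unitors) that is suppressed in the graphical calculus. -/

/-! ### C*-2-categories -/

/-- A C*-2-category: a dagger 2-category whose spaces of 2-morphisms are complex Banach spaces,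
with (bi)linear vertical and horizontal composition, antilinear dagger, submultiplicative norm,
the C*-identity, and positivity of `f† ∘ f` in the C*-algebra of endomorphisms. -/
class CStarTwoCategory (B : Type u) [Bicategory.{w, v} B] where
  [homNormed : ∀ {a b : B} (X Y : a ⟶ b), NormedAddCommGroup (X ⟶ Y)]
  [homSpace : ∀ {a b : B} (X Y : a ⟶ b), NormedSpace ℂ (X ⟶ Y)]
  [homComplete : ∀ {a b : B} (X Y : a ⟶ b), CompleteSpace (X ⟶ Y)]
  /-- the dagger of a 2-morphism -/
  dag : ∀ {a b : B} {X Y : a ⟶ b}, (X ⟶ Y) → (Y ⟶ X)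
  add_comp : ∀ {a b : B} {X Y Z : a ⟶ b} (f g : X ⟶ Y) (h : Y ⟶ Z),
    (f + g) ≫ h = f ≫ h + g ≫ h
  comp_add : ∀ {a b : B} {X Y Z : a ⟶ b} (f : X ⟶ Y) (g h : Y ⟶ Z),
    f ≫ (g + h) = f ≫ g + f ≫ h
  smul_comp : ∀ {a b : B} {X Y Z : a ⟶ b} (c : ℂ) (f : X ⟶ Y) (g : Y ⟶ Z),
    (c • f) ≫ g = c • (f ≫ g)
  comp_smul : ∀ {a b : B} {X Y Z : a ⟶ b} (c : ℂ) (f : X ⟶ Y) (g : Y ⟶ Z),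
    f ≫ (c • g) = c • (f ≫ g)
  whiskerLeft_add : ∀ {a b c : B} (Z : a ⟶ b) {X Y : b ⟶ c} (f g : X ⟶ Y),
    Z ◁ (f + g) = Z ◁ f + Z ◁ g
  whiskerLeft_smul : ∀ {a b c : B} (Z : a ⟶ b) {X Y : b ⟶ c} (k : ℂ) (f : X ⟶ Y),
    Z ◁ (k • f) = k • (Z ◁ f)
  add_whiskerRight : ∀ {a b c : B} {X Y : a ⟶ b} (f g : X ⟶ Y) (Z : b ⟶ c),
    (f + g) ▷ Z = f ▷ Z + g ▷ Z
  smul_whiskerRight : ∀ {a b c : B} {X Y : a ⟶ b} (k : ℂ) (f : X ⟶ Y) (Z : b ⟶ c),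
    (k • f) ▷ Z = k • (f ▷ Z)
  dag_dag : ∀ {a b : B} {X Y : a ⟶ b} (f : X ⟶ Y), dag (dag f) = f
  dag_id : ∀ {a b : B} (X : a ⟶ b), dag (𝟙 X) = 𝟙 X
  dag_comp : ∀ {a b : B} {X Y Z : a ⟶ b} (f : X ⟶ Y) (g : Y ⟶ Z),
    dag (f ≫ g) = dag g ≫ dag f
  dag_add : ∀ {a b : B} {X Y : a ⟶ b} (f g : X ⟶ Y), dag (f + g) = dag f + dag g
  dag_smul : ∀ {a b : B} {X Y : a ⟶ b} (c : ℂ) (f : X ⟶ Y),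
    dag (c • f) = (starRingEnd ℂ c) • dag f
  dag_whiskerLeft : ∀ {a b c : B} (Z : a ⟶ b) {X Y : b ⟶ c} (f : X ⟶ Y),
    dag (Z ◁ f) = Z ◁ dag f
  dag_whiskerRight : ∀ {a b c : B} {X Y : a ⟶ b} (f : X ⟶ Y) (Z : b ⟶ c),
    dag (f ▷ Z) = dag f ▷ Z
  dag_associator : ∀ {a b c d : B} (X : a ⟶ b) (Y : b ⟶ c) (Z : c ⟶ d),
    dag (α_ X Y Z).hom = (α_ X Y Z).inv
  dag_leftUnitor : ∀ {a b : B} (X : a ⟶ b), dag (λ_ X).hom = (λ_ X).inv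
  dag_rightUnitor : ∀ {a b : B} (X : a ⟶ b), dag (ρ_ X).hom = (ρ_ X).inv
  norm_comp_le : ∀ {a b : B} {X Y Z : a ⟶ b} (f : X ⟶ Y) (g : Y ⟶ Z),
    ‖f ≫ g‖ ≤ ‖f‖ * ‖g‖
  norm_comp_dag : ∀ {a b : B} {X Y : a ⟶ b} (f : X ⟶ Y), ‖f ≫ dag f‖ = ‖f‖ ^ 2
  /-- `f† ∘ f` is a positive element of the C*-algebra `End(X)`, i.e. of the form `g† ∘ g` with
  `g ∈ End(X)`. -/
  comp_dag_positive : ∀ {a b : B} {X Y : a ⟶ b} (f : X ⟶ Y),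
    ∃ g : X ⟶ X, f ≫ dag f = g ≫ dag g

attribute [reducible, instance] CStarTwoCategory.homNormed CStarTwoCategory.homSpace
attribute [instance] CStarTwoCategory.homComplete

/-- The dagger `f† : Y → X` of a 2-morphism `f : X → Y`. -/
abbrev dag {B : Type u} [Bicategory.{w, v} B] [CStarTwoCategory B] {a b : B} {X Y : a ⟶ b}
    (f : X ⟶ Y) : Y ⟶ X := CStarTwoCategory.dag f

variable {B : Type u} [Bicategory.{w, v} B] [CStarTwoCategory B]

/-! ### Kinds of 2-morphisms -/

section TwoMorphisms

variable {a b : B} {X Y : a ⟶ b}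

/-- `f† ∘ f = id`. -/
def IsIsometry (f : X ⟶ Y) : Prop := f ≫ dag f = 𝟙 X

/-- `f† ∘ f = id` and `f ∘ f† = id`. -/
def IsUnitary (f : X ⟶ Y) : Prop := f ≫ dag f = 𝟙 X ∧ dag f ≫ f = 𝟙 Y

/-- `f† ∘ f` is idempotent. -/
def IsPartialIsometry (f : X ⟶ Y) : Prop := (f ≫ dag f) ≫ (f ≫ dag f) = f ≫ dag f

/-- `f = g† ∘ g` for some 2-morphism `g : X → X'`. -/
def IsPositive (f : X ⟶ X) : Prop := ∃ (X' : a ⟶ b) (g : X ⟶ X'), f = g ≫ dag g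

/-- A dagger idempotent (projection): `p = p† = p ∘ p`. -/
def IsDaggerIdempotent (p : X ⟶ X) : Prop := dag p = p ∧ p ≫ p = p

open Classical in
/-- The positive square root of a positive element of the C*-algebra `End(X)` (with value `0`
where there is none). -/
def posSqrt (f : X ⟶ X) : X ⟶ X :=
  if h : ∃ p : X ⟶ X, IsPositive p ∧ p ≫ p = f then h.choose else 0

open Classical in
/-- The inverse of an invertible element of `End(X)` (with value `0` where there is none). -/
def inverse (f : X ⟶ X) : X ⟶ X :=
  if h : IsIso f then @CategoryTheory.inv _ _ _ _ f h else 0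

/-- The absolute value `|f| = (f† ∘ f)^{1/2}` of a 2-morphism. -/
def absVal (f : X ⟶ Y) : X ⟶ X := posSqrt (f ≫ dag f)

/-- `p` is the support of `x`: the least projection `p` with `p ∘ x = x ∘ p = x`. -/
def IsSupport (x p : X ⟶ X) : Prop :=
  (IsDaggerIdempotent p ∧ p ≫ x = x ∧ x ≫ p = x) ∧
    ∀ q : X ⟶ X, IsDaggerIdempotent q → q ≫ x = x → x ≫ q = x → p ≫ q = p

/-- Unitary isomorphism of 1-morphisms. -/
def UnitarilyIsomorphic (X Y : a ⟶ b) : Prop := ∃ f : X ⟶ Y, IsUnitary f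

/-- A zero 1-morphism: its endomorphism space is zero-dimensional. -/
def IsZeroOneMor (X : a ⟶ b) : Prop := ∀ f : X ⟶ X, f = 0

/-- A simple 1-morphism: `End(X) ≅ ℂ`. -/
def IsSimpleOneMor (X : a ⟶ b) : Prop := Module.finrank ℂ (X ⟶ X) = 1

/-- `S` is a direct sum of the finite family `x` of 1-morphisms: there are isometries
`v i : x i → S` with `∑ i, v i ∘ (v i)† = id`. -/
def IsDirectSum {ι : Type} [Fintype ι] (x : ι → (a ⟶ b)) (S : a ⟶ b) : Prop :=
  ∃ v : ∀ i, x i ⟶ S, (∀ i, IsIsometry (v i)) ∧ ∑ i, dag (v i) ≫ v i = 𝟙 S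

end TwoMorphisms

/-! ### Presemisimple C*-2-categories -/

/-- A zero object: its endomorphism category is the terminal category. -/
def IsZeroObj (z : B) : Prop := Nonempty ((z ⟶ z) ≌ Discrete PUnit.{1})

/-- `S` is a direct sum of the finite family `r` of objects. -/
def IsObjDirectSum {ι : Type} [Fintype ι] (r : ι → B) (S : B) : Prop :=
  ∃ (inc : ∀ i, r i ⟶ S) (proj : ∀ i, S ⟶ r i),
    (∀ i, UnitarilyIsomorphic (inc i ≫ proj i) (𝟙 (r i))) ∧
    (∀ i j, i ≠ j → IsZeroOneMor (inc i ≫ proj j)) ∧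
    IsDirectSum (fun i => proj i ≫ inc i) (𝟙 S)

/-- A presemisimple C*-2-category: locally semisimple, rigid, additive, and every object is a
finite direct sum of objects with simple identity. -/
class IsPresemisimple (B : Type u) [Bicategory.{w, v} B] [CStarTwoCategory B] : Prop where
  /-- local additivity: zero 1-morphisms -/
  exists_zero : ∀ a b : B, ∃ Z : a ⟶ b, IsZeroOneMor Z
  /-- local additivity: direct sums of 1-morphisms -/
  exists_directSum : ∀ {a b : B} (X Y : a ⟶ b), ∃ S : a ⟶ b, IsDirectSum ![X, Y] S
  /-- local idempotent completeness: dagger idempotents split -/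
  idempotents_split : ∀ {a b : B} {X : a ⟶ b} (p : X ⟶ X), IsDaggerIdempotent p →
    ∃ (V : a ⟶ b) (i : V ⟶ X), IsIsometry i ∧ dag i ≫ i = p
  /-- endomorphism algebras are finite-dimensional -/
  finiteDimensional : ∀ {a b : B} (X : a ⟶ b), FiniteDimensional ℂ (X ⟶ X)
  /-- rigidity: every 1-morphism `X : a → b` has a right dual `X* : b → a`, with
  `η : id_b → X* ⊗ X` and `ε : X ⊗ X* → id_a` -/
  rigid : ∀ {a b : B} (X : a ⟶ b), ∃ Xd : b ⟶ a, Nonempty (Xd ⊣ X)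
  exists_zeroObj : ∃ z : B, IsZeroObj z
  exists_objDirectSum : ∀ r₁ r₂ : B, ∃ S : B, IsObjDirectSum ![r₁, r₂] S
  finite_sum_of_simples : ∀ S : B, ∃ (n : ℕ) (r : Fin n → B),
    (∀ i, IsSimpleOneMor (𝟙 (r i))) ∧ IsObjDirectSum r S

/-! ### Standard duals -/

/-- Left multiplication by `x` on the commutative algebra `End(id_r)`. -/
def mulEnd {r : B} (x : 𝟙 r ⟶ 𝟙 r) : (𝟙 r ⟶ 𝟙 r) →ₗ[ℂ] (𝟙 r ⟶ 𝟙 r) where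
  toFun y := x ≫ y
  map_add' y z := CStarTwoCategory.comp_add x y z
  map_smul' c y := CStarTwoCategory.comp_smul c x y

/-- The canonical trace `Tr_r : End(id_r) → ℂ` on the finite-dimensional commutative C*-algebra
`End(id_r) ≅ ℂⁿ`, which sends every minimal projection to `1`: the trace of the multiplication
operator. -/
def canTrace {r : B} (x : 𝟙 r ⟶ 𝟙 r) : ℂ := LinearMap.trace ℂ (𝟙 r ⟶ 𝟙 r) (mulEnd x)

/-- The canonical trace is linear and sends a minimal projection (a nonzero idempotent `p` with
`p · End(id_r) = ℂ p`) to `1`. -/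
theorem canTrace_spec [IsPresemisimple B] {r : B} :
    (∀ x y : 𝟙 r ⟶ 𝟙 r, canTrace (x + y) = canTrace x + canTrace y) ∧
    (∀ (c : ℂ) (x : 𝟙 r ⟶ 𝟙 r), canTrace (c • x) = c * canTrace x) ∧
    ∀ p : 𝟙 r ⟶ 𝟙 r, p ≠ 0 → p ≫ p = p → (∀ x : 𝟙 r ⟶ 𝟙 r, ∃ c : ℂ, p ≫ x = c • p) →
      canTrace p = 1 := by
  have : FiniteDimensional ℂ (𝟙 r ⟶ 𝟙 r) := IsPresemisimple.finiteDimensional (𝟙 r)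
  refine ⟨fun x y => ?_, fun c x => ?_, fun p hp hpp hmin => ?_⟩
  · have : mulEnd (x + y) = mulEnd x + mulEnd y :=
      LinearMap.ext fun z => CStarTwoCategory.add_comp x y z
    simp [canTrace, this]
  · have : mulEnd (c • x) = c • mulEnd x :=
      LinearMap.ext fun z => CStarTwoCategory.smul_comp c x z
    simp [canTrace, this]
  · choose φ hφ using hmin
    have inj : ∀ c d : ℂ, c • p = d • p → c = d := fun c d h => smul_left_injective ℂ hp h
    let L : (𝟙 r ⟶ 𝟙 r) →ₗ[ℂ] ℂ :=
      { toFun := φ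
        map_add' := fun x y => inj _ _ (by
          rw [← hφ, CStarTwoCategory.comp_add, hφ, hφ, add_smul])
        map_smul' := fun c x => inj _ _ (by
          rw [← hφ, CStarTwoCategory.comp_smul, hφ, RingHom.id_apply, smul_eq_mul, mul_smul]) }
    have hL : mulEnd p = L.smulRight p := LinearMap.ext fun x => hφ x
    have h1 : φ p = 1 := inj _ _ (by rw [← hφ, hpp, one_smul])
    rw [canTrace, hL, LinearMap.trace_smulRight]
    exact h1

/-- The duality `[X*, η, ε]`, with cup `η` and cap `ε`, is standard: for every `T ∈ End(X)`,
`Tr_b(η† ∘ (id ⊗ T) ∘ η) = Tr_a(ε ∘ (T ⊗ id) ∘ ε†)`. -/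
def IsStandardDuality {a b : B} {X : a ⟶ b} {Xd : b ⟶ a}
    (cup : 𝟙 b ⟶ Xd ≫ X) (cap : X ≫ Xd ⟶ 𝟙 a) : Prop :=
  ∀ T : X ⟶ X,
    canTrace (cup ≫ Xd ◁ T ≫ dag cup) = canTrace (dag cap ≫ T ▷ Xd ≫ cap)

/-- A standard right dual `[X*, η, ε]` of `X : a → b`; the snake equations are those of Mathlib's
`Bicategory.Adjunction`. -/
structure StandardDual {a b : B} (X : a ⟶ b) where
  /-- the dual 1-morphism `X*` -/
  dual : b ⟶ a
  /-- `η` (the unit), `ε` (the counit) and the snake equations -/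
  adj : dual ⊣ X
  standard : IsStandardDuality adj.unit adj.counit

namespace StandardDual

variable {a b : B} {X : a ⟶ b} (D : StandardDual X)

/-- The right cup `η : id_b → X* ⊗ X`. -/
abbrev cup : 𝟙 b ⟶ D.dual ≫ X := D.adj.unit

/-- The right cap `ε : X ⊗ X* → id_a`. -/
abbrev cap : X ≫ D.dual ⟶ 𝟙 a := D.adj.counit

/-- The left dimension `dim_L(X) = η† ∘ η ∈ End(id_b)`. -/
def dimL : 𝟙 b ⟶ 𝟙 b := D.cup ≫ dag D.cup

/-- The quantum dimension `d(X) = Tr_b(dim_L(X))`, a nonnegative real number. -/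
def qdim : ℝ := (canTrace D.dimL).re

/-- `X` is separable: `dim_L(X)` is invertible. -/
def IsSeparable : Prop := IsIso D.dimL

/-- `n_X = dim_L(X)^{1/2}`. -/
def n : 𝟙 b ⟶ 𝟙 b := posSqrt D.dimL

/-- `n_X^{-1}`. -/
def nInv : 𝟙 b ⟶ 𝟙 b := inverse D.n

/-- `n_X^{1/2}`. -/
def nSqrt : 𝟙 b ⟶ 𝟙 b := posSqrt D.n

/-- `n_X^{-1/2}`. -/
def nInvSqrt : 𝟙 b ⟶ 𝟙 b := inverse D.nSqrt

end StandardDual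

/-! ### Standard separable Frobenius algebras -/

/-- The data of an algebra in the monoidal category `End(r)`. -/
structure AlgData (r : B) where
  obj : r ⟶ r
  mul : obj ≫ obj ⟶ obj
  one : 𝟙 r ⟶ obj

namespace AlgData

variable {r : B}

/-- The Frobenius cup `m† ∘ u : id → A ⊗ A`. -/
def cup (A : AlgData r) : 𝟙 r ⟶ A.obj ≫ A.obj := A.one ≫ dag A.mul

/-- The Frobenius cap `u† ∘ m : A ⊗ A → id`. -/
def cap (A : AlgData r) : A.obj ≫ A.obj ⟶ 𝟙 r := A.mul ≫ dag A.one

/-- Standard separable Frobenius algebras (SSFAs) in `End(r)`. -/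
structure IsSSFA (A : AlgData r) : Prop where
  assoc : A.mul ▷ A.obj ≫ A.mul = (α_ A.obj A.obj A.obj).hom ≫ A.obj ◁ A.mul ≫ A.mul
  one_mul : A.one ▷ A.obj ≫ A.mul = (λ_ A.obj).hom
  mul_one : A.obj ◁ A.one ≫ A.mul = (ρ_ A.obj).hom
  frobenius_left :
    dag A.mul ▷ A.obj ≫ (α_ A.obj A.obj A.obj).hom ≫ A.obj ◁ A.mul = A.mul ≫ dag A.mul
  frobenius_right :
    A.obj ◁ dag A.mul ≫ (α_ A.obj A.obj A.obj).inv ≫ A.mul ▷ A.obj = A.mul ≫ dag A.mul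
  separable : dag A.mul ≫ A.mul = 𝟙 A.obj
  standard : IsStandardDuality A.cup A.cap

/-- Unitary `*`-isomorphisms of algebras: unitary 2-morphisms `f : A → A'` preserving
multiplication and unit, such that `f†` is the transpose of `f` with respect to the Frobenius
cups and caps. -/
structure IsUnitaryStarIso (A A' : AlgData r) (f : A.obj ⟶ A'.obj) : Prop where
  unitary : IsUnitary f
  map_mul : A.mul ≫ f = f ▷ A.obj ≫ A'.obj ◁ f ≫ A'.mul
  map_one : A.one ≫ f = A'.one
  map_star : dag f =
    𝟙 A'.obj ⊗≫ A.cup ▷ A'.obj ⊗≫ A.obj ◁ f ▷ A'.obj ⊗≫ A.obj ◁ A'.cap ⊗≫ 𝟙 A.obj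

/-- The CP condition for `f : A → A'`: the 2-morphism
`(id_A ⊗ m_{A'}) ∘ (id_A ⊗ f ⊗ id_{A'}) ∘ (m_A† ⊗ id_{A'}) : A ⊗ A' → A ⊗ A'`
equals `g† ∘ g` for some object `S` of `End(r)` and some `g : A ⊗ A' → S`. -/
def IsCP (A A' : AlgData r) (f : A.obj ⟶ A'.obj) : Prop :=
  ∃ (S : r ⟶ r) (g : A.obj ≫ A'.obj ⟶ S),
    dag A.mul ▷ A'.obj ⊗≫ A.obj ◁ f ▷ A'.obj ⊗≫ A.obj ◁ A'.mul = g ≫ dag g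

/-- A channel: a CP morphism preserving the counit, `u_{A'}† ∘ f = u_A†`. -/
def IsChannel (A A' : AlgData r) (f : A.obj ⟶ A'.obj) : Prop :=
  IsCP A A' f ∧ f ≫ dag A'.one = dag A.one

end AlgData

/-- The normalised pair of pants algebra on `X ⊗ X*`, with multiplication
`id_X ⊗ (n_X^{-1} ∘ η†) ⊗ id_{X*}` and unit `(id_X ⊗ n_X ⊗ id_{X*}) ∘ ε†`. -/
abbrev StandardDual.pairOfPants {r s : B} {X : r ⟶ s} (D : StandardDual X) : AlgData r where
  obj := X ≫ D.dual
  mul := 𝟙 ((X ≫ D.dual) ≫ (X ≫ D.dual)) ⊗≫ X ◁ (dag D.cup ≫ D.nInv) ▷ D.dual ⊗≫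
    𝟙 (X ≫ D.dual)
  one := dag D.cap ⊗≫ X ◁ D.n ▷ D.dual ⊗≫ 𝟙 (X ≫ D.dual)

/-- A semisimple C*-2-category: presemisimple, and every SSFA in every `End(r)` splits, i.e. is
unitarily `*`-isomorphic to the pair of pants algebra of a separable 1-morphism out of `r`. -/
class IsSemisimple (B : Type u) [Bicategory.{w, v} B] [CStarTwoCategory B] : Prop
    extends IsPresemisimple B where
  ssfa_split : ∀ {r : B} (A : AlgData r), A.IsSSFA →
    ∃ (s : B) (X : r ⟶ s) (D : StandardDual X), D.IsSeparable ∧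
      ∃ f : A.obj ⟶ X ≫ D.dual, AlgData.IsUnitaryStarIso A D.pairOfPants f

/-! ### Dilations -/

section Dilations

variable {r s t : B} {X : r ⟶ s} {Y : r ⟶ t} {E : t ⟶ s}

/-- The conjugate `τ_* = (τ†)^* : X* → (Y ⊗ E)^* = E* ⊗ Y*` of `τ : X → Y ⊗ E`: the right
transpose (mate) of `τ† : Y ⊗ E → X`, with the nested dual for `Y ⊗ E`. -/
def conj (DX : StandardDual X) (DY : StandardDual Y) (DE : StandardDual E) (τ : X ⟶ Y ≫ E) :
    DX.dual ⟶ DE.dual ≫ DY.dual :=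
  (conjugateEquiv (DE.adj.comp DY.adj) DX.adj).symm (dag τ)

/-- `(id_Y ⊗ ε_E ⊗ id_{Y*}) ∘ (τ ⊗ τ_*) : X ⊗ X* → Y ⊗ Y*`. -/
def dilationMap (DX : StandardDual X) (DY : StandardDual Y) (DE : StandardDual E)
    (τ : X ⟶ Y ≫ E) : X ≫ DX.dual ⟶ Y ≫ DY.dual :=
  τ ▷ DX.dual ≫ (Y ≫ E) ◁ conj DX DY DE τ ⊗≫ Y ◁ DE.cap ▷ DY.dual ⊗≫ 𝟙 (Y ≫ DY.dual)

/-- `τ : X → Y ⊗ E` is a dilation of `f : X ⊗ X* → Y ⊗ Y*`. -/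
def IsDilation (DX : StandardDual X) (DY : StandardDual Y) (DE : StandardDual E)
    (τ : X ⟶ Y ≫ E) (f : X ≫ DX.dual ⟶ Y ≫ DY.dual) : Prop :=
  f = dilationMap DX DY DE τ

/-- The normalised dilation `(id_Y ⊗ n_Y^{1/2} ⊗ id_E) ∘ τ ∘ (id_X ⊗ n_X^{-1/2}) : X → Y ⊗ E`. -/
def normalised (DX : StandardDual X) (DY : StandardDual Y) (τ : X ⟶ Y ≫ E) : X ⟶ Y ≫ E :=
  𝟙 X ⊗≫ X ◁ DX.nInvSqrt ⊗≫ τ ⊗≫ Y ◁ DY.nSqrt ▷ E ⊗≫ 𝟙 (Y ≫ E)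

/-- `τ : X → Y ⊗ E` is a dilation of `f` whose environment has minimal quantum dimension among
all dilations of `f`. -/
def IsMinimalDilation (DX : StandardDual X) (DY : StandardDual Y) (DE : StandardDual E)
    (τ : X ⟶ Y ≫ E) (f : X ≫ DX.dual ⟶ Y ≫ DY.dual) : Prop :=
  IsDilation DX DY DE τ f ∧
    ∀ (E' : t ⟶ s) (DE' : StandardDual E') (τ' : X ⟶ Y ≫ E'),
      IsDilation DX DY DE' τ' f → DE.qdim ≤ DE'.qdim

/-- The 2-morphism `τ̃ : Y* ⊗ X → E` obtained from `τ : X → Y ⊗ E` by bending the `Y`-wire down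
with the left cap `η_Y† : Y* ⊗ Y → id_t`. -/
def bend (DY : StandardDual Y) (τ : X ⟶ Y ≫ E) : DY.dual ≫ X ⟶ E :=
  DY.dual ◁ τ ⊗≫ dag DY.cup ▷ E ⊗≫ 𝟙 E

end Dilations

end CovStinespring

end

open CovStinespring

/-!
The theorem reduces to factorisations `g ≫ dag g` of a positive operator in one hom-category.

To `f : X ⊗ X* → Y ⊗ Y*` one attaches two Choi operators: `outerChoi f` on `X* ⊗ Y` and
`innerChoi f` on `Y* ⊗ X`. Straightening wires shows that `τ` is a dilation of `f` exactly when
`innerChoi f = τ̃ ≫ dag τ̃` for the bent 2-morphism `τ̃ = bend DY τ` (`isDilation_iff`); here no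
standardness is needed, and `τ ↦ τ̃` is a bijection. The CP condition, on the other hand, says that
`outerChoi f`, multiplied by invertible positive scalars and whiskered by `X` and `Y*`, is positive;
as `X` and `Y` are separable, the whiskering can be removed by closing the outer wires, so `f` is CP
exactly when `outerChoi f` is positive (`isCP_iff_isPositive_outerChoi`). The two Choi operators are
transposes of each other (`leftMate_outerChoi`), and for standard dualities transposition is a
`*`-anti-isomorphism. Hence CP morphisms are those with a positive inner Choi operator, which gives
dilations in both directions.

The fact behind the last step is that left and right transposes agree for standard duals
(`StandardDual.rightMate_eq_leftMate`). It follows that the standard trace is cyclic and independent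
of all choices, so that the quantum dimension is strictly monotone under isometries.
Standard duals exist on every 1-morphism: the two traces of any duality are positive definite
functionals on a finite-dimensional C⋆-algebra, and the geometric mean of their densities with
respect to the regular trace gives the rescaling that equates them.

Two dilations give two factorisations of one positive operator, so they differ by a partial isometry
(`exists_partialIsometry`, from a Moore-Penrose inverse). Compression to the support of `|τ̃†|`
makes `τ̃` left cancellable; the partial isometry to any other dilation is then an isometry, and
monotonicity of the quantum dimension gives minimality and its uniqueness. Finally, being a channel
and `τ̂` being an isometry both say `τ† (id_Y ⊗ n_Y ⊗ id_E) τ = id_X ⊗ n_X`.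
-/

noncomputable section

namespace CovStinespring

/-! ### The regular trace of a finite-dimensional C⋆-algebra -/

section RegularTrace

open scoped ComplexOrder

variable {A : Type*} [CStarAlgebra A]

/-- The trace of the regular representation: `a` goes to the trace of right multiplication by `a`.
On `End (𝟙 r)` it is the canonical trace. -/
def regTrace : A →ₗ[ℂ] ℂ := LinearMap.trace ℂ A ∘ₗ (LinearMap.mul ℂ A).flip

theorem regTrace_apply (a : A) : regTrace a = LinearMap.trace ℂ A (LinearMap.mulRight ℂ a) := rfl

theorem regTrace_mul_comm [FiniteDimensional ℂ A] (a b : A) :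
    regTrace (a * b) = regTrace (b * a) := by
  simp only [regTrace_apply, LinearMap.mulRight_mul]
  exact LinearMap.trace_mul_comm ℂ _ _

theorem mem_spectrum_of_hasEigenvalue {a : A} {μ : ℂ}
    (h : Module.End.HasEigenvalue (LinearMap.mulRight ℂ a) μ) : μ ∈ spectrum ℂ a := by
  obtain ⟨b, hb⟩ := h.exists_hasEigenvector
  rw [spectrum.mem_iff]
  intro hu
  refine hb.2 ?_
  have h1 : b * a = μ • b := by simpa using hb.apply_eq_smul
  have h2 : b * (algebraMap ℂ A μ - a) = 0 := by
    rw [mul_sub, h1, Algebra.algebraMap_eq_smul_one, mul_smul_comm, mul_one, sub_self]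
  exact (hu.mul_left_eq_zero).1 h2

variable [FiniteDimensional ℂ A]

theorem hasEigenvalue_of_mem_spectrum {a : A} {μ : ℂ} (h : μ ∈ spectrum ℂ a) :
    Module.End.HasEigenvalue (LinearMap.mulRight ℂ a) μ := by
  by_contra hne
  apply (spectrum.mem_iff.1 h)
  have hinj : Function.Injective (LinearMap.mulRight ℂ (algebraMap ℂ A μ - a)) := by
    rw [← LinearMap.ker_eq_bot, LinearMap.ker_eq_bot']
    intro b hb
    by_contra hb0
    refine hne (Module.End.hasEigenvalue_of_hasEigenvector (x := b)
      ⟨Module.End.mem_eigenspace_iff.2 ?_, hb0⟩)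
    have : b * (algebraMap ℂ A μ - a) = 0 := by simpa using hb
    rw [mul_sub, Algebra.algebraMap_eq_smul_one, mul_smul_comm, mul_one, sub_eq_zero] at this
    simpa using this.symm
  obtain ⟨c, hc⟩ := LinearMap.surjective_of_injective hinj 1
  have hc' : c * (algebraMap ℂ A μ - a) = 1 := by simpa using hc
  have hc'' : (algebraMap ℂ A μ - a) * c = 1 := hinj (by
    simp only [LinearMap.mulRight_apply]
    rw [mul_assoc, hc', one_mul, mul_one])
  exact ⟨⟨_, c, hc'', hc'⟩, rfl⟩

/-- The regular trace is positive and faithful, because it is the sum of the spectrum of its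
argument, counted with multiplicity. -/
theorem regTrace_star_mul_self (a : A) :
    ∃ x : ℝ, 0 ≤ x ∧ regTrace (star a * a) = x ∧ (x = 0 → a = 0) := by
  set T := LinearMap.mulRight ℂ (star a * a) with hT
  have hroot : ∀ μ ∈ T.charpoly.roots, 0 ≤ μ := by
    intro μ hμ
    have h1 : Module.End.HasEigenvalue T μ := by
      rw [Module.End.hasEigenvalue_iff_isRoot_charpoly]
      exact (Polynomial.mem_roots'.1 hμ).2
    have h2 := mem_spectrum_of_hasEigenvalue h1
    have hsa : IsSelfAdjoint (star a * a) := IsSelfAdjoint.star_mul_self a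
    have h3 := hsa.mem_spectrum_eq_re h2
    rw [h3] at h2 ⊢
    have h4 := spectrum_star_mul_self_nonneg μ.re
      (by simpa using spectrum.algebraMap_mem_iff ℂ |>.1 h2)
    exact_mod_cast h4
  have htr : regTrace (star a * a) = T.charpoly.roots.sum :=
    Module.End.trace_eq_sum_roots_charpoly_of_splits (IsAlgClosed.splits _)
  have hnn : 0 ≤ T.charpoly.roots.sum := Multiset.sum_nonneg hroot
  obtain ⟨h1, h2⟩ := Complex.nonneg_iff.1 hnn
  refine ⟨T.charpoly.roots.sum.re, h1, ?_, fun h0 => ?_⟩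
  · rw [htr]; apply Complex.ext <;> simp [← h2]
  · have hz : T.charpoly.roots.sum = 0 := Complex.ext h0 h2.symm
    have hall : ∀ μ ∈ T.charpoly.roots, μ = 0 := by
      intro μ hμ
      refine le_antisymm ?_ (hroot μ hμ)
      rw [← hz]
      exact Multiset.single_le_sum hroot _ hμ
    have hspec : spectrum ℂ (star a * a) ⊆ {0} := by
      intro μ hμ
      have := hasEigenvalue_of_mem_spectrum hμ
      rw [Module.End.hasEigenvalue_iff_isRoot_charpoly] at this
      exact hall μ ((Polynomial.mem_roots (LinearMap.charpoly_monic _).ne_zero).2 this)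
    have := CFC.eq_zero_of_spectrum_subset_zero (R := ℂ) (star a * a) hspec
      (IsSelfAdjoint.star_mul_self a).isStarNormal
    simpa using this

/-- Polarisation: a functional that is real on all `star a * a` is hermitian. -/
theorem map_star_of_real_on_star_mul_self {A : Type*} [CStarAlgebra A] (φ : A →ₗ[ℂ] ℂ)
    (h : ∀ a, ∃ x : ℝ, φ (star a * a) = x) (a : A) : φ (star a) = starRingEnd ℂ (φ a) := by
  obtain ⟨x, hx⟩ := h a
  obtain ⟨y, hy⟩ := h 1
  obtain ⟨z, hz⟩ := h (a + 1)
  obtain ⟨t, ht⟩ := h (a + Complex.I • 1)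
  simp only [star_add, add_mul, mul_add, map_add, star_one, one_mul, mul_one, star_smul,
    smul_mul_assoc, mul_smul_comm, map_smul, smul_eq_mul] at hx hy hz ht
  rw [hx, hy] at hz ht
  have e1 := congrArg Complex.im hz
  have e2 := congrArg Complex.im ht
  have e3 := congrArg Complex.re ht
  simp at e1 e2 e3
  apply Complex.ext <;> simp <;> linarith

theorem regTrace_star (a : A) : regTrace (star a) = starRingEnd ℂ (regTrace a) :=
  map_star_of_real_on_star_mul_self _
    (fun a => let ⟨x, _, hx, _⟩ := regTrace_star_mul_self a; ⟨x, hx⟩) a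

/-- Positive definiteness of a functional: `φ (star a * a)` is a nonnegative real number, and it
vanishes only for `a = 0`. -/
def IsPosDefFunctional {A : Type*} [CStarAlgebra A] (φ : A →ₗ[ℂ] ℂ) : Prop :=
  ∀ a, ∃ x : ℝ, 0 ≤ x ∧ φ (star a * a) = x ∧ (x = 0 → a = 0)

theorem isUnit_of_forall_mul_eq_zero {a : A} (h : ∀ x, a * x = 0 → x = 0) : IsUnit a := by
  have hinj : Function.Injective (LinearMap.mulLeft ℂ a) := by
    rw [← LinearMap.ker_eq_bot, LinearMap.ker_eq_bot']
    exact fun x hx => h x (by simpa using hx)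
  obtain ⟨c, hc⟩ := LinearMap.surjective_of_injective hinj 1
  have hc' : a * c = 1 := by simpa using hc
  have hc'' : c * a = 1 := hinj (by
    simp only [LinearMap.mulLeft_apply]
    rw [← mul_assoc, hc', one_mul, mul_one])
  exact ⟨⟨_, c, hc', hc''⟩, rfl⟩

theorem eq_of_regTrace_mul_eq {a b : A} (h : ∀ x, regTrace (a * x) = regTrace (b * x)) :
    a = b := by
  obtain ⟨x, -, hx, h0⟩ := regTrace_star_mul_self (a - b)
  rw [← sub_eq_zero]
  apply h0
  rw [regTrace_mul_comm, sub_mul, map_sub, h, sub_self] at hx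
  exact_mod_cast hx.symm

theorem exists_eq_regTrace_mul (φ : A →ₗ[ℂ] ℂ) : ∃ d : A, ∀ x, φ x = regTrace (d * x) := by
  let F : A →ₗ[ℂ] Module.Dual ℂ A := (LinearMap.mul ℂ A).compr₂ regTrace
  have hF : ∀ d x, F d x = regTrace (d * x) := fun d x => rfl
  have hinj : Function.Injective F := fun a b hab => eq_of_regTrace_mul_eq fun x => by
    rw [← hF, ← hF, hab]
  have hsurj : Function.Surjective F :=
    (LinearMap.injective_iff_surjective_of_finrank_eq_finrank
      (Subspace.dual_finrank_eq (K := ℂ) (V := A)).symm).1 hinj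
  obtain ⟨d, hd⟩ := hsurj φ
  exact ⟨d, fun x => by rw [← hF, hd]⟩

/-- A positive definite functional has a positive invertible density with respect to the regular
trace. -/
theorem IsPosDefFunctional.exists_density [PartialOrder A] [StarOrderedRing A] {φ : A →ₗ[ℂ] ℂ}
    (hφ : IsPosDefFunctional φ) :
    ∃ d : A, 0 ≤ d ∧ IsUnit d ∧ ∀ x, φ x = regTrace (d * x) := by
  obtain ⟨d, hd⟩ := exists_eq_regTrace_mul φ
  have hsa : IsSelfAdjoint d := by
    refine eq_of_regTrace_mul_eq fun x => ?_
    rw [← hd, ← star_star x, ← star_mul, regTrace_star, regTrace_mul_comm, ← hd,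
      map_star_of_real_on_star_mul_self φ
        (fun a => let ⟨x, _, hx, _⟩ := hφ a; ⟨x, hx⟩), Complex.conj_conj, star_star]
  refine ⟨d, ?_, ?_, hd⟩
  · -- evaluating `φ` at the negative part of `d` shows that this part vanishes
    obtain ⟨s, hs⟩ := CStarAlgebra.nonneg_iff_eq_star_mul_self.1 (CFC.negPart_nonneg d)
    obtain ⟨x, hx, hx', -⟩ := hφ s
    obtain ⟨y, hy, hy', hy0⟩ := regTrace_star_mul_self d⁻
    rw [(CFC.negPart_nonneg d).isSelfAdjoint.star_eq] at hy'
    have h1 : d * d⁻ = -(d⁻ * d⁻) := by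
      nth_rw 1 [← CFC.posPart_sub_negPart d hsa]
      rw [sub_mul, CFC.posPart_mul_negPart, zero_sub]
    rw [← hs, hd, h1, map_neg, hy'] at hx'
    have h2 : -y = x := by exact_mod_cast hx'
    exact (CFC.negPart_eq_zero_iff d hsa).1 (hy0 (by linarith))
  · refine isUnit_of_forall_mul_eq_zero fun x hx => ?_
    obtain ⟨y, -, hy', hy0⟩ := hφ (star x)
    rw [star_star, hd, ← mul_assoc, hx, zero_mul, map_zero] at hy'
    simpa using hy0 (by exact_mod_cast hy'.symm)

/-- Two positive definite functionals are intertwined by conjugation with a positive invertible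
element, the square root of the geometric mean of the densities. -/
theorem IsPosDefFunctional.exists_intertwiner {φ ψ : A →ₗ[ℂ] ℂ} (hφ : IsPosDefFunctional φ)
    (hψ : IsPosDefFunctional ψ) :
    ∃ k l : A, IsSelfAdjoint k ∧ k * l = 1 ∧ l * k = 1 ∧
      ∀ x, φ (k * x * k) = ψ (l * x * l) := by
  let _ := CStarAlgebra.spectralOrder A
  have := CStarAlgebra.spectralOrderedRing A
  obtain ⟨d, hd, hdu, hdφ⟩ := hφ.exists_density
  obtain ⟨e, he, heu, heψ⟩ := hψ.exists_density
  -- `g` is the geometric mean of `d⁻¹` and `e`: it satisfies `g * d * g = e`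
  obtain ⟨s, hs⟩ := (CFC.isUnit_sqrt_iff d).2 hdu
  have hs2 : (s : A) * s = d := by rw [hs, CFC.sqrt_mul_sqrt_self d]
  have hss : IsSelfAdjoint (s : A) := by rw [hs]; exact (CFC.sqrt_nonneg d).isSelfAdjoint
  have hsi : IsSelfAdjoint ((s⁻¹ : Aˣ) : A) := by
    have := congrArg (Units.val ∘ Inv.inv) (Units.ext hss.star_eq : star s = s)
    simpa [IsSelfAdjoint] using this
  have hm0 : 0 ≤ (s : A) * e * s := by
    simpa [hss.star_eq] using star_left_conjugate_nonneg he (s : A)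
  set m := CFC.sqrt ((s : A) * e * s) with hm
  have hm2 : m * m = s * e * s := CFC.sqrt_mul_sqrt_self _
  set g : A := ↑s⁻¹ * m * ↑s⁻¹ with hg
  have hg0 : 0 ≤ g := by
    simpa [hsi.star_eq] using
      star_left_conjugate_nonneg (CFC.sqrt_nonneg (s * e * s)) (↑s⁻¹ : A)
  have hgg : g * d * g = e := by
    rw [hg, ← hs2]
    calc _ = (↑s⁻¹ : A) * (m * (↑s⁻¹ * s) * (s * ↑s⁻¹) * m) * ↑s⁻¹ := by simp only [mul_assoc]
      _ = (↑s⁻¹ * s) * e * (s * ↑s⁻¹) := by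
        rw [Units.inv_mul, Units.mul_inv, mul_one, mul_one, hm2]; simp only [mul_assoc]; simp
      _ = e := by simp
  have hmu : IsUnit m := by
    rw [hm, CFC.isUnit_sqrt_iff _]
    exact (s.isUnit.mul heu).mul s.isUnit
  have hgu : IsUnit g := ((s⁻¹).isUnit.mul hmu).mul (s⁻¹).isUnit
  obtain ⟨k, hk⟩ := (CFC.isUnit_sqrt_iff g).2 hgu
  have hk2 : (k : A) * k = g := by rw [hk, CFC.sqrt_mul_sqrt_self g]
  refine ⟨k, ↑k⁻¹, by rw [hk]; exact (CFC.sqrt_nonneg g).isSelfAdjoint, by simp, by simp,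
    fun x => ?_⟩
  have key : (k : A) * d * k = ↑k⁻¹ * e * ↑k⁻¹ := by
    rw [← hgg, ← hk2]; simp [mul_assoc]
  calc φ (k * x * k) = regTrace (d * (k * x) * k) := by rw [hdφ]; simp only [mul_assoc]
    _ = regTrace (k * d * k * x) := by rw [regTrace_mul_comm]; simp only [mul_assoc]
    _ = regTrace (↑k⁻¹ * (e * ↑k⁻¹ * x)) := by rw [key]; simp only [mul_assoc]
    _ = ψ (↑k⁻¹ * x * ↑k⁻¹) := by rw [regTrace_mul_comm, heψ]; simp only [mul_assoc]

/-- A self-adjoint element of a finite-dimensional C⋆-algebra is a right multiple of its square. -/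
theorem exists_sq_mul_eq {p : A} (hp : IsSelfAdjoint p) :
    ∃ r : A, p * p * r = p := by
  have hker : LinearMap.ker (LinearMap.mulLeft ℂ (p * p)) =
      LinearMap.ker (LinearMap.mulLeft ℂ p) := by
    ext x
    simp only [LinearMap.mem_ker, LinearMap.mulLeft_apply]
    refine ⟨fun h => ?_, fun h => by rw [mul_assoc, h, mul_zero]⟩
    rw [← CStarRing.star_mul_self_eq_zero_iff, star_mul, hp.star_eq, mul_assoc, ← mul_assoc p, h,
      mul_zero]
  have hle : LinearMap.range (LinearMap.mulLeft ℂ (p * p)) ≤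
      LinearMap.range (LinearMap.mulLeft ℂ p) := by
    rintro _ ⟨x, rfl⟩
    exact ⟨p * x, by simp⟩
  have heq := Submodule.eq_of_le_of_finrank_eq hle (by
    have h1 := LinearMap.finrank_range_add_finrank_ker (LinearMap.mulLeft ℂ (p * p))
    have h2 := LinearMap.finrank_range_add_finrank_ker (LinearMap.mulLeft ℂ p)
    rw [hker] at h1
    omega)
  have : p ∈ LinearMap.range (LinearMap.mulLeft ℂ (p * p)) := by
    rw [heq]; exact ⟨1, by simp⟩
  obtain ⟨r, hr⟩ := this
  exact ⟨r, hr⟩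

end RegularTrace

section CStarTwoCategories

variable {B : Type u} [Bicategory.{w, v} B] [CStarTwoCategory B]

/-! ### Calculus of the dagger -/

section Dagger
variable {a b c d : B} {X Y Z : a ⟶ b}

@[simp] theorem dag_dag (f : X ⟶ Y) : dag (dag f) = f := CStarTwoCategory.dag_dag f
@[simp] theorem dag_id (X : a ⟶ b) : dag (𝟙 X) = 𝟙 X := CStarTwoCategory.dag_id X
@[simp] theorem dag_comp (f : X ⟶ Y) (g : Y ⟶ Z) : dag (f ≫ g) = dag g ≫ dag f :=
  CStarTwoCategory.dag_comp f g
@[simp] theorem dag_whiskerLeft (Z : a ⟶ b) {X Y : b ⟶ c} (f : X ⟶ Y) :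
    dag (Z ◁ f) = Z ◁ dag f := CStarTwoCategory.dag_whiskerLeft Z f
@[simp] theorem dag_whiskerRight (f : X ⟶ Y) (Z : b ⟶ c) : dag (f ▷ Z) = dag f ▷ Z :=
  CStarTwoCategory.dag_whiskerRight f Z
@[simp] theorem dag_associator_hom (X : a ⟶ b) (Y : b ⟶ c) (Z : c ⟶ d) :
    dag (α_ X Y Z).hom = (α_ X Y Z).inv := CStarTwoCategory.dag_associator X Y Z
@[simp] theorem dag_associator_inv (X : a ⟶ b) (Y : b ⟶ c) (Z : c ⟶ d) :
    dag (α_ X Y Z).inv = (α_ X Y Z).hom := by rw [← dag_associator_hom, dag_dag]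
@[simp] theorem dag_leftUnitor_hom (X : a ⟶ b) : dag (λ_ X).hom = (λ_ X).inv :=
  CStarTwoCategory.dag_leftUnitor X
@[simp] theorem dag_leftUnitor_inv (X : a ⟶ b) : dag (λ_ X).inv = (λ_ X).hom := by
  rw [← dag_leftUnitor_hom, dag_dag]
@[simp] theorem dag_rightUnitor_hom (X : a ⟶ b) : dag (ρ_ X).hom = (ρ_ X).inv :=
  CStarTwoCategory.dag_rightUnitor X
@[simp] theorem dag_rightUnitor_inv (X : a ⟶ b) : dag (ρ_ X).inv = (ρ_ X).hom := by
  rw [← dag_rightUnitor_hom, dag_dag]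

theorem dag_add (f g : X ⟶ Y) : dag (f + g) = dag f + dag g := CStarTwoCategory.dag_add f g
theorem add_comp (f g : X ⟶ Y) (h : Y ⟶ Z) : (f + g) ≫ h = f ≫ h + g ≫ h :=
  CStarTwoCategory.add_comp f g h
theorem comp_add (f : X ⟶ Y) (g h : Y ⟶ Z) : f ≫ (g + h) = f ≫ g + f ≫ h :=
  CStarTwoCategory.comp_add f g h
theorem zero_comp (f : Y ⟶ Z) : (0 : X ⟶ Y) ≫ f = 0 := by
  simpa using (add_comp (0 : X ⟶ Y) 0 f).symm
theorem comp_zero (f : X ⟶ Y) : f ≫ (0 : Y ⟶ Z) = 0 := by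
  simpa using (comp_add f (0 : Y ⟶ Z) 0).symm
theorem neg_comp (f : X ⟶ Y) (g : Y ⟶ Z) : (-f) ≫ g = -(f ≫ g) :=
  eq_neg_of_add_eq_zero_left (by rw [← add_comp, neg_add_cancel, zero_comp])
theorem comp_neg (f : X ⟶ Y) (g : Y ⟶ Z) : f ≫ (-g) = -(f ≫ g) :=
  eq_neg_of_add_eq_zero_left (by rw [← comp_add, neg_add_cancel, comp_zero])
theorem sub_comp (f g : X ⟶ Y) (h : Y ⟶ Z) : (f - g) ≫ h = f ≫ h - g ≫ h := by
  rw [sub_eq_add_neg, add_comp, neg_comp, sub_eq_add_neg]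
theorem comp_sub (f : X ⟶ Y) (g h : Y ⟶ Z) : f ≫ (g - h) = f ≫ g - f ≫ h := by
  rw [sub_eq_add_neg, comp_add, comp_neg, sub_eq_add_neg]
theorem dag_zero : dag (0 : X ⟶ Y) = 0 := by simpa using dag_add (0 : X ⟶ Y) 0
theorem dag_sub (f g : X ⟶ Y) : dag (f - g) = dag f - dag g := by
  rw [eq_sub_iff_add_eq, ← dag_add, sub_add_cancel]

theorem comp_dag_eq_zero {f : X ⟶ Y} : f ≫ dag f = 0 ↔ f = 0 := by
  refine ⟨fun h => ?_, fun h => by rw [h, zero_comp]⟩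
  have := CStarTwoCategory.norm_comp_dag f
  change ‖f ≫ dag f‖ = _ at this
  rw [h, norm_zero] at this
  exact norm_eq_zero.1 (pow_eq_zero_iff two_ne_zero |>.1 this.symm)

theorem dag_comp_eq_zero {f : X ⟶ Y} : dag f ≫ f = 0 ↔ f = 0 := by
  have := comp_dag_eq_zero (f := dag f)
  rw [dag_dag] at this
  rw [this]
  exact ⟨fun h => by rw [← dag_dag f, h, dag_zero], fun h => by rw [h, dag_zero]⟩

end Dagger

/-! ### The C*-algebra of endomorphisms -/

section EndAlgebra
variable {a b : B} {X Y : a ⟶ b}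

instance : NormedAddCommGroup (End X) := inferInstanceAs (NormedAddCommGroup (X ⟶ X))
instance : CompleteSpace (End X) := inferInstanceAs (CompleteSpace (X ⟶ X))

/-- `End X` as a normed ring, with the opposite of the diagrammatic composition as product. -/
instance : NormedRing (End X) where
  __ := (inferInstance : NormedAddCommGroup (End X))
  __ := (inferInstance : Monoid (End X))
  left_distrib f g h := add_comp (X := X) (Y := X) (Z := X) g h f
  right_distrib f g h := comp_add (X := X) (Y := X) (Z := X) h f g
  zero_mul f := comp_zero (X := X) (Y := X) (Z := X) f
  mul_zero f := zero_comp (X := X) (Y := X) (Z := X) f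
  norm_mul_le f g := (CStarTwoCategory.norm_comp_le (X := X) (Y := X) (Z := X) g f).trans_eq
    (mul_comm _ _)

instance : NormedAlgebra ℂ (End X) where
  toSMul := inferInstanceAs (SMul ℂ (X ⟶ X))
  algebraMap :=
    { toFun := fun c => (c • 𝟙 X : X ⟶ X)
      map_one' := one_smul ℂ (𝟙 X)
      map_mul' := fun c d => by
        change (c * d) • 𝟙 X = (d • 𝟙 X) ≫ (c • 𝟙 X)
        rw [CStarTwoCategory.smul_comp, Category.id_comp, smul_smul, mul_comm]
      map_zero' := zero_smul ℂ (𝟙 X)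
      map_add' := fun c d => add_smul c d (𝟙 X) }
  commutes' c f := by
    change (f : X ⟶ X) ≫ (c • 𝟙 X) = (c • 𝟙 X) ≫ f
    rw [CStarTwoCategory.smul_comp, CStarTwoCategory.comp_smul, Category.id_comp,
      Category.comp_id]
  smul_def' c f := by
    have h := CStarTwoCategory.comp_smul (X := X) (Y := X) (Z := X) c f (𝟙 X)
    rw [Category.comp_id] at h
    exact h.symm
  norm_smul_le c f := norm_smul_le (β := X ⟶ X) c f

/-- The dagger as star operation on `End X`. -/
instance : StarRing (End X) where
  star f := dag (X := X) (Y := X) f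
  star_involutive f := dag_dag (X := X) (Y := X) f
  star_mul f g := dag_comp (X := X) (Y := X) (Z := X) g f
  star_add f g := dag_add (X := X) (Y := X) f g

instance : CStarAlgebra (End X) where
  norm_mul_self_le f := by
    have := CStarTwoCategory.norm_comp_dag (X := X) (Y := X) f
    rw [sq] at this
    exact this.ge
  star_smul c f := CStarTwoCategory.dag_smul (X := X) (Y := X) c f

instance [IsPresemisimple B] : FiniteDimensional ℂ (End X) :=
  IsPresemisimple.finiteDimensional X

end EndAlgebra

/-! ### Positivity, square roots and inverses -/

section Positivity
variable {a b : B} {X Y Z : a ⟶ b}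

theorem isPositive_iff_exists_end {p : X ⟶ X} : IsPositive p ↔ ∃ g : X ⟶ X, p = g ≫ dag g := by
  refine ⟨?_, fun ⟨g, hg⟩ => ⟨X, g, hg⟩⟩
  rintro ⟨X', g, rfl⟩
  exact CStarTwoCategory.comp_dag_positive g

theorem isPositive_comp_dag (f : X ⟶ Y) : IsPositive (f ≫ dag f) := ⟨Y, f, rfl⟩

theorem IsPositive.dag_eq {p : X ⟶ X} (hp : IsPositive p) : dag p = p := by
  obtain ⟨X', g, rfl⟩ := hp
  simp

theorem IsPositive.conj {p : X ⟶ X} (hp : IsPositive p) (f : Y ⟶ X) :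
    IsPositive (f ≫ p ≫ dag f) := by
  obtain ⟨X', g, rfl⟩ := hp
  exact ⟨X', f ≫ g, by simp⟩

theorem exists_positive_sqrt {f : X ⟶ X} (hf : IsPositive f) :
    ∃ p : X ⟶ X, IsPositive p ∧ p ≫ p = f := by
  obtain ⟨g, rfl⟩ := isPositive_iff_exists_end.1 hf
  let _ := CStarAlgebra.spectralOrder (End X)
  have := CStarAlgebra.spectralOrderedRing (End X)
  have h0 : (0 : End X) ≤ star (End.of g) * End.of g := star_mul_self_nonneg _
  obtain ⟨h, hh⟩ := CStarAlgebra.nonneg_iff_eq_star_mul_self.1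
    (CFC.sqrt_nonneg (star (End.of g) * End.of g))
  refine ⟨CFC.sqrt (A := End X) (star (End.of g) * End.of g), ⟨X, h, hh⟩, ?_⟩
  exact CFC.sqrt_mul_sqrt_self (A := End X) (star (End.of g) * End.of g)

theorem posSqrt_spec {f : X ⟶ X} (hf : IsPositive f) :
    IsPositive (posSqrt f) ∧ posSqrt f ≫ posSqrt f = f := by
  have h := exists_positive_sqrt hf
  rw [posSqrt, dif_pos h]
  exact h.choose_spec

theorem comp_inverse {f : X ⟶ X} (hf : IsIso f) : f ≫ inverse f = 𝟙 X := by
  rw [inverse, dif_pos hf, IsIso.hom_inv_id]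

theorem inverse_comp {f : X ⟶ X} (hf : IsIso f) : inverse f ≫ f = 𝟙 X := by
  rw [inverse, dif_pos hf, IsIso.inv_hom_id]

theorem dag_inverse {f : X ⟶ X} (hf : IsIso f) (hd : dag f = f) : dag (inverse f) = inverse f := by
  rw [← cancel_epi f, comp_inverse hf]
  nth_rw 1 [← hd]
  rw [← dag_comp, inverse_comp hf, dag_id]

theorem isIso_of_comp_self {f p : X ⟶ X} (hf : IsIso f) (h : p ≫ p = f) : IsIso p := by
  have h1 : p ≫ p ≫ inverse f = 𝟙 X := by rw [← Category.assoc, h, comp_inverse hf]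
  have h2 : (inverse f ≫ p) ≫ p = 𝟙 X := by rw [Category.assoc, h, inverse_comp hf]
  have h3 : inverse f ≫ p = p ≫ inverse f := by
    rw [← Category.comp_id (inverse f ≫ p), ← h1, ← Category.assoc, h2, Category.id_comp]
  exact ⟨p ≫ inverse f, h1, by rw [← h3, h2]⟩

/-- Right cancellation of `dag h` from `h ≫ dag h`, by the C⋆-identity. -/
theorem comp_left_cancel_of_comp_dag {f g : X ⟶ Y} {h : Y ⟶ Z}
    (e : f ≫ h ≫ dag h = g ≫ h ≫ dag h) : f ≫ h = g ≫ h := by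
  -- `v = f ≫ h - g ≫ h` satisfies `v ≫ dag v = 0`
  rw [← sub_eq_zero, ← comp_dag_eq_zero]
  simp only [dag_sub, dag_comp, comp_sub, sub_comp, Category.assoc]
  simp only [← Category.assoc] at e ⊢
  rw [e]
  simp

section Support
variable [IsPresemisimple B]

/-- The Moore-Penrose inverse `q` of a self-adjoint `p`, with the projection `e = p ≫ q` on its
range. -/
theorem exists_pseudoinverse {p : X ⟶ X} (hp : dag p = p) :
    ∃ q e : X ⟶ X, dag q = q ∧ IsDaggerIdempotent e ∧ p ≫ q = e ∧ q ≫ p = e ∧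
      e ≫ p = p ∧ p ≫ e = p ∧ e ≫ q = q := by
  obtain ⟨r, hr⟩ := exists_sq_mul_eq (A := End X) (p := p) hp
  replace hr : r ≫ p ≫ p = p := hr
  have hr' : p ≫ p ≫ dag r = p := by simpa [hp] using congrArg dag hr
  have he : r ≫ p = p ≫ dag r := by
    calc r ≫ p = r ≫ p ≫ p ≫ dag r := by rw [hr']
      _ = (r ≫ p ≫ p) ≫ dag r := by simp only [Category.assoc]
      _ = p ≫ dag r := by rw [hr]
  have hpe : p ≫ r ≫ p = p := by rw [he, hr']
  have hee : (r ≫ p) ≫ r ≫ p = r ≫ p := by rw [Category.assoc, hpe]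
  have hed : dag (r ≫ p) = r ≫ p := by rw [dag_comp, hp, he]
  refine ⟨r ≫ p ≫ dag r, r ≫ p, by simp [hp], ⟨hed, hee⟩, ?_, ?_, by simpa using hr, hpe, ?_⟩
  · rw [← Category.assoc r, ← Category.assoc, hpe, he]
  · rw [← he, Category.assoc, Category.assoc, hr]
  · rw [← Category.assoc r p, ← Category.assoc, hee]

/-- A factorisation form of the polar decomposition: two 2-morphisms with the same `a ≫ dag a`
differ by a partial isometry. -/
theorem exists_partialIsometry {W E₁ E₂ : a ⟶ b} {f : W ⟶ E₁} {g : W ⟶ E₂}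
    (h : f ≫ dag f = g ≫ dag g) :
    ∃ α : E₁ ⟶ E₂, IsPartialIsometry α ∧ IsPartialIsometry (dag α) ∧
      f ≫ α = g ∧ g ≫ dag α = f := by
  obtain ⟨q, e, hq, -, hpq, hqp, hep, -, heq⟩ :=
    exists_pseudoinverse (isPositive_comp_dag f).dag_eq
  have hef : e ≫ f = f := by
    simpa using comp_left_cancel_of_comp_dag (f := e) (g := 𝟙 W) (h := f) (by simpa using hep)
  have heg : e ≫ g = g := by
    simpa using comp_left_cancel_of_comp_dag (f := e) (g := 𝟙 W) (h := g)
      (by simpa [← h] using hep)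
  have hqfq : q ≫ f ≫ dag f ≫ q = q := by
    rw [← Category.assoc f, ← Category.assoc q, hqp, heq]
  have hqgq : q ≫ g ≫ dag g ≫ q = q := by
    rw [← Category.assoc g, ← h, ← Category.assoc q, hqp, heq]
  have hqfq' {Z : a ⟶ b} (k : W ⟶ Z) : q ≫ f ≫ dag f ≫ q ≫ k = q ≫ k := by
    simpa using congrArg (· ≫ k) hqfq
  have hqgq' {Z : a ⟶ b} (k : W ⟶ Z) : q ≫ g ≫ dag g ≫ q ≫ k = q ≫ k := by
    simpa using congrArg (· ≫ k) hqgq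
  refine ⟨dag f ≫ q ≫ g, ?_, ?_, ?_, ?_⟩
  · simp only [IsPartialIsometry, dag_comp, dag_dag, hq, Category.assoc, hqfq', hqgq']
  · simp only [IsPartialIsometry, dag_comp, dag_dag, hq, Category.assoc, hqfq', hqgq']
  · rw [← Category.assoc, ← Category.assoc, hpq, heg]
  · simp only [dag_comp, dag_dag, hq, Category.assoc]
    rw [← Category.assoc g, ← h, ← Category.assoc, hpq, hef]

/-- The support of `x` is the range projection of `x`. -/
theorem exists_isSupport {p : X ⟶ X} (hp : dag p = p) : ∃ e, IsSupport p e := by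
  obtain ⟨q, e, -, he, -, hqp, hep, hpe, -⟩ := exists_pseudoinverse hp
  exact ⟨e, ⟨he, hep, hpe⟩, fun s _ _ hps => by rw [← hqp, Category.assoc, hps]⟩

/-- The support of a self-adjoint `p` annihilates whatever `p` annihilates. -/
theorem IsSupport.comp_eq_zero {p e : X ⟶ X} (h : IsSupport p e) (hp : dag p = p) {f : X ⟶ Y}
    (hf : p ≫ f = 0) : e ≫ f = 0 := by
  obtain ⟨q, e', -, he', -, hqp, hep, hpe, -⟩ := exists_pseudoinverse hp
  rw [← h.2 e' he' hep hpe, ← hqp]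
  simp only [Category.assoc, hf, comp_zero]

end Support

end Positivity

/-! ### The canonical trace -/

section CanTrace
variable {r : B}

theorem canTrace_smul (c : ℂ) (x : 𝟙 r ⟶ 𝟙 r) : canTrace (c • x) = c * canTrace x :=
  map_smul (regTrace (A := End (𝟙 r))) c x
theorem canTrace_add (x y : 𝟙 r ⟶ 𝟙 r) : canTrace (x + y) = canTrace x + canTrace y :=
  map_add (regTrace (A := End (𝟙 r))) x y
/-- The canonical trace is positive and faithful. -/
theorem canTrace_comp_dag [IsPresemisimple B] {Z : r ⟶ r} (f : 𝟙 r ⟶ Z) :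
    ∃ x : ℝ, 0 ≤ x ∧ canTrace (f ≫ dag f) = x ∧ (x = 0 → f = 0) := by
  obtain ⟨g, hg⟩ := CStarTwoCategory.comp_dag_positive f
  obtain ⟨x, hx, hx', h0⟩ := regTrace_star_mul_self (End.of g)
  refine ⟨x, hx, ?_, fun h => ?_⟩
  · rw [← hx']; exact congrArg canTrace hg
  · have : g = 0 := h0 h
    rw [← comp_dag_eq_zero]
    exact hg.trans (by rw [this, zero_comp])

end CanTrace

end CStarTwoCategories

section Duality

variable {B : Type u} [Bicategory.{w, v} B]

/-! ### Mates and dagger adjunctions -/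

section Mates
variable {a b : B} {l₁ l₂ : a ⟶ b} {r₁ r₂ : b ⟶ a} (adj₁ : l₁ ⊣ r₁) (adj₂ : l₂ ⊣ r₂)

theorem unit_comp_conjugateEquiv (f : l₂ ⟶ l₁) :
    adj₁.unit ≫ l₁ ◁ conjugateEquiv adj₁ adj₂ f = adj₂.unit ≫ f ▷ r₂ := by
  rw [conjugateEquiv_apply']
  calc
    _ = 𝟙 _ ⊗≫ (adj₁.unit ▷ 𝟙 a ≫ (l₁ ≫ r₁) ◁ (adj₂.unit ≫ f ▷ r₂)) ⊗≫
          l₁ ◁ adj₁.counit ▷ r₂ ⊗≫ 𝟙 _ := by bicategory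
    _ = (adj₂.unit ≫ f ▷ r₂) ⊗≫ leftZigzag adj₁.unit adj₁.counit ▷ r₂ ⊗≫ 𝟙 _ := by
      rw [← whisker_exchange]; bicategory
    _ = _ := by rw [adj₁.left_triangle]; bicategory

theorem conjugateEquiv_comp_counit (f : l₂ ⟶ l₁) :
    conjugateEquiv adj₁ adj₂ f ▷ l₂ ≫ adj₂.counit = r₁ ◁ f ≫ adj₁.counit := by
  rw [conjugateEquiv_apply']
  calc
    _ = 𝟙 _ ⊗≫ r₁ ◁ adj₂.unit ▷ l₂ ⊗≫ ((r₁ ◁ f ≫ adj₁.counit) ▷ (r₂ ≫ l₂) ≫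
          𝟙 b ◁ adj₂.counit) ⊗≫ 𝟙 _ := by bicategory
    _ = 𝟙 _ ⊗≫ r₁ ◁ leftZigzag adj₂.unit adj₂.counit ⊗≫ (r₁ ◁ f ≫ adj₁.counit) := by
      rw [← whisker_exchange]; bicategory
    _ = _ := by rw [adj₂.left_triangle]; bicategory

theorem unit_comp_whiskerLeft (f : r₁ ⟶ r₂) :
    adj₁.unit ≫ l₁ ◁ f = adj₂.unit ≫ (conjugateEquiv adj₁ adj₂).symm f ▷ r₂ := by
  rw [← unit_comp_conjugateEquiv adj₁ adj₂, Equiv.apply_symm_apply]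

theorem whiskerRight_comp_counit (f : r₁ ⟶ r₂) :
    f ▷ l₂ ≫ adj₂.counit = r₁ ◁ (conjugateEquiv adj₁ adj₂).symm f ≫ adj₁.counit := by
  rw [← conjugateEquiv_comp_counit adj₁ adj₂, Equiv.apply_symm_apply]

end Mates

variable [CStarTwoCategory B]

theorem whiskerLeft_add {a b c : B} (Z : a ⟶ b) {X Y : b ⟶ c} (f g : X ⟶ Y) :
    Z ◁ (f + g) = Z ◁ f + Z ◁ g := CStarTwoCategory.whiskerLeft_add Z f g
theorem add_whiskerRight {a b c : B} {X Y : a ⟶ b} (f g : X ⟶ Y) (Z : b ⟶ c) :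
    (f + g) ▷ Z = f ▷ Z + g ▷ Z := CStarTwoCategory.add_whiskerRight f g Z
theorem whiskerLeft_zero {a b c : B} (Z : a ⟶ b) {X Y : b ⟶ c} :
    Z ◁ (0 : X ⟶ Y) = 0 := by simpa using whiskerLeft_add Z (0 : X ⟶ Y) 0

section DaggerAdjunction

theorem dag_compUnit {a b c : B} {f₁ : a ⟶ b} {g₁ : b ⟶ a} {f₂ : b ⟶ c} {g₂ : c ⟶ b}
    (adj₁ : f₁ ⊣ g₁) (adj₂ : f₂ ⊣ g₂) : dag (adj₁.comp adj₂).unit =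
      𝟙 _ ⊗≫ f₁ ◁ dag adj₂.unit ▷ g₁ ⊗≫ dag adj₁.unit := by
  simp [bicategoricalComp]

theorem dag_compCounit {a b c : B} {f₁ : a ⟶ b} {g₁ : b ⟶ a} {f₂ : b ⟶ c} {g₂ : c ⟶ b}
    (adj₁ : f₁ ⊣ g₁) (adj₂ : f₂ ⊣ g₂) : dag (adj₁.comp adj₂).counit =
      dag adj₂.counit ⊗≫ g₂ ◁ dag adj₁.counit ▷ f₂ ⊗≫ 𝟙 _ := by
  simp [bicategoricalComp]

variable {a b : B} {l : a ⟶ b} {r : b ⟶ a}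

/-- The dagger of an adjunction `l ⊣ r` is an adjunction `r ⊣ l`. -/
def daggerAdj (adj : l ⊣ r) : r ⊣ l where
  unit := dag adj.counit
  counit := dag adj.unit
  left_triangle := by
    have h := congrArg dag adj.right_triangle
    simpa [rightZigzag, leftZigzag, bicategoricalComp] using h
  right_triangle := by
    have h := congrArg dag adj.left_triangle
    simpa [rightZigzag, leftZigzag, bicategoricalComp] using h

@[simp] theorem daggerAdj_unit (adj : l ⊣ r) : (daggerAdj adj).unit = dag adj.counit := rfl
@[simp] theorem daggerAdj_counit (adj : l ⊣ r) : (daggerAdj adj).counit = dag adj.unit := rfl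

/-- Bending a wire along an adjunction is injective. -/
theorem unit_whiskerLeft_eq_zero (adj : l ⊣ r) {Z : b ⟶ a} {f : r ⟶ Z}
    (h : adj.unit ≫ l ◁ f = 0) : f = 0 := by
  have : adj.homEquiv₁.symm ((ρ_ _).hom ≫ f) = adj.homEquiv₁.symm 0 := by
    rw [Adjunction.homEquiv₁_symm_apply, Adjunction.homEquiv₁_symm_apply, whiskerLeft_zero,
      comp_zero, comp_zero, comp_zero]
    calc _ = 𝟙 _ ⊗≫ (adj.unit ≫ l ◁ f) ⊗≫ 𝟙 _ := by bicategory
      _ = 0 := by rw [h]; simp [bicategoricalComp]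
  have h2 := adj.homEquiv₁.symm.injective this
  rw [← cancel_epi (ρ_ r).hom, h2, comp_zero]

variable {l₁ l₂ : a ⟶ b} {r₁ r₂ : b ⟶ a} (adj₁ : l₁ ⊣ r₁) (adj₂ : l₂ ⊣ r₂)

theorem conjugateEquiv_add (f g : l₂ ⟶ l₁) : conjugateEquiv adj₁ adj₂ (f + g) =
    conjugateEquiv adj₁ adj₂ f + conjugateEquiv adj₁ adj₂ g := by
  simp only [conjugateEquiv_apply', whiskerLeft_add, add_whiskerRight, comp_add, add_comp]

theorem conjugateEquiv_sub (f g : l₂ ⟶ l₁) : conjugateEquiv adj₁ adj₂ (f - g) =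
    conjugateEquiv adj₁ adj₂ f - conjugateEquiv adj₁ adj₂ g := by
  rw [eq_sub_iff_add_eq, ← conjugateEquiv_add, sub_add_cancel]

theorem conjugateEquiv_symm_sub (f g : r₁ ⟶ r₂) : (conjugateEquiv adj₁ adj₂).symm (f - g) =
    (conjugateEquiv adj₁ adj₂).symm f - (conjugateEquiv adj₁ adj₂).symm g := by
  rw [Equiv.symm_apply_eq, conjugateEquiv_sub, Equiv.apply_symm_apply, Equiv.apply_symm_apply]

theorem dag_conjugateEquiv_symm (f : r₁ ⟶ r₂) :
    dag ((conjugateEquiv adj₁ adj₂).symm f) =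
      conjugateEquiv (daggerAdj adj₁) (daggerAdj adj₂) (dag f) := by
  simp [conjugateEquiv_symm_apply', conjugateEquiv_apply']

end DaggerAdjunction

/-! ### The trace of a standard duality -/

section PairingTrace
variable {a b : B} {X : a ⟶ b} {Xd : b ⟶ a}

/-- The functional `T ↦ Tr_b(η† ∘ (id ⊗ T) ∘ η)` on `End X` given by a cup `η`. -/
def cupTrace (cup : 𝟙 b ⟶ Xd ≫ X) : End X →ₗ[ℂ] ℂ where
  toFun T := canTrace (cup ≫ Xd ◁ (show X ⟶ X from T) ≫ dag cup)
  map_add' S T := by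
    rw [← canTrace_add, ← comp_add, ← add_comp, ← whiskerLeft_add]
  map_smul' c T := by
    rw [RingHom.id_apply, smul_eq_mul, ← canTrace_smul, ← CStarTwoCategory.comp_smul,
      ← CStarTwoCategory.smul_comp, ← CStarTwoCategory.whiskerLeft_smul]

/-- The functional `T ↦ Tr_a(ε ∘ (T ⊗ id) ∘ ε†)` on `End X` given by a cap `ε`. -/
def capTrace (cap : X ≫ Xd ⟶ 𝟙 a) : End X →ₗ[ℂ] ℂ where
  toFun T := canTrace (dag cap ≫ (show X ⟶ X from T) ▷ Xd ≫ cap)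
  map_add' S T := by
    rw [← canTrace_add, ← comp_add, ← add_comp, ← add_whiskerRight]
  map_smul' c T := by
    rw [RingHom.id_apply, smul_eq_mul, ← canTrace_smul, ← CStarTwoCategory.comp_smul,
      ← CStarTwoCategory.smul_comp, ← CStarTwoCategory.smul_whiskerRight]

theorem cupTrace_apply (cup : 𝟙 b ⟶ Xd ≫ X) (T : X ⟶ X) :
    cupTrace cup T = canTrace (cup ≫ Xd ◁ T ≫ dag cup) := rfl
theorem capTrace_apply (cap : X ≫ Xd ⟶ 𝟙 a) (T : X ⟶ X) :
    capTrace cap T = canTrace (dag cap ≫ T ▷ Xd ≫ cap) := rfl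

theorem cupTrace_comp_dag [IsPresemisimple B] (adj : Xd ⊣ X) {Z : a ⟶ b} (f : X ⟶ Z) :
    ∃ x : ℝ, 0 ≤ x ∧ cupTrace adj.unit (f ≫ dag f) = x ∧ (x = 0 → f = 0) := by
  obtain ⟨x, hx, hx', h0⟩ := canTrace_comp_dag (adj.unit ≫ Xd ◁ f)
  refine ⟨x, hx, ?_, fun h => unit_whiskerLeft_eq_zero adj (h0 h)⟩
  rw [← hx', cupTrace_apply]
  simp

theorem isPosDefFunctional_cupTrace [IsPresemisimple B] (adj : Xd ⊣ X) :
    IsPosDefFunctional (cupTrace adj.unit) := fun g => cupTrace_comp_dag adj (X := X) (Z := X) g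

theorem isPosDefFunctional_capTrace [IsPresemisimple B] (adj : Xd ⊣ X) :
    IsPosDefFunctional (capTrace adj.counit) := by
  intro g
  obtain ⟨x, hx, hx', h0⟩ := canTrace_comp_dag (dag adj.counit ≫ (show X ⟶ X from g) ▷ Xd)
  refine ⟨x, hx, ?_, fun h => ?_⟩
  · rw [← hx']
    change capTrace adj.counit ((show X ⟶ X from g) ≫ dag (show X ⟶ X from g)) = _
    rw [capTrace_apply]
    simp
  · have h1 := h0 h
    rw [← daggerAdj_unit, ← unit_comp_conjugateEquiv (daggerAdj adj) (daggerAdj adj)] at h1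
    have h2 := unit_whiskerLeft_eq_zero _ h1
    have h3 : Bicategory.conjugateEquiv (daggerAdj adj) (daggerAdj adj) g =
        Bicategory.conjugateEquiv (daggerAdj adj) (daggerAdj adj) 0 := by
      rw [h2, ← sub_self (0 : X ⟶ X), conjugateEquiv_sub, sub_self]
    exact (Bicategory.conjugateEquiv _ _).injective h3

end PairingTrace

/-! ### Standard duals -/

namespace StandardDual
variable {a b : B}

theorem cupTrace_eq_capTrace {X : a ⟶ b} (D : StandardDual X) (T : X ⟶ X) :
    cupTrace D.cup T = capTrace D.cap T := D.standard T

section Mates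
variable {X Y : a ⟶ b} (D : StandardDual X) (D' : StandardDual Y)

/-- The right transpose `Y* → X*` of `f : X → Y`. -/
def rightMate (f : X ⟶ Y) : D'.dual ⟶ D.dual := (Bicategory.conjugateEquiv D.adj D'.adj).symm f

/-- The left transpose `Y* → X*` of `f : X → Y`, which uses the daggers of the cups and caps. -/
def leftMate (f : X ⟶ Y) : D'.dual ⟶ D.dual :=
  Bicategory.conjugateEquiv (daggerAdj D'.adj) (daggerAdj D.adj) f

theorem rightMate_sub (f g : X ⟶ Y) :
    rightMate D D' (f - g) = rightMate D D' f - rightMate D D' g :=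
  conjugateEquiv_symm_sub _ _ _ _

theorem leftMate_sub (f g : X ⟶ Y) :
    leftMate D D' (f - g) = leftMate D D' f - leftMate D D' g :=
  conjugateEquiv_sub _ _ _ _

theorem exists_leftMate_eq (f : D'.dual ⟶ D.dual) : ∃ g : X ⟶ Y, leftMate D D' g = f :=
  (Bicategory.conjugateEquiv _ _).surjective f

theorem exists_rightMate_eq (f : D'.dual ⟶ D.dual) : ∃ g : X ⟶ Y, rightMate D D' g = f :=
  (Bicategory.conjugateEquiv _ _).symm.surjective f

theorem dag_rightMate (f : X ⟶ Y) : dag (rightMate D D' f) = leftMate D' D (dag f) :=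
  dag_conjugateEquiv_symm _ _ _

theorem cup_comp (f : X ⟶ Y) : D.cup ≫ D.dual ◁ f = D'.cup ≫ rightMate D D' f ▷ Y :=
  unit_comp_whiskerLeft _ _ f

theorem comp_cap (f : X ⟶ Y) : f ▷ D'.dual ≫ D'.cap = X ◁ rightMate D D' f ≫ D.cap :=
  whiskerRight_comp_counit _ _ f

theorem dag_cap_comp (f : X ⟶ Y) :
    dag D.cap ≫ f ▷ D.dual = dag D'.cap ≫ Y ◁ leftMate D D' f :=
  (unit_comp_conjugateEquiv (daggerAdj D'.adj) (daggerAdj D.adj) f).symm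

theorem comp_dag_cup (f : X ⟶ Y) :
    D'.dual ◁ f ≫ dag D'.cup = leftMate D D' f ▷ X ≫ dag D.cup :=
  (conjugateEquiv_comp_counit (daggerAdj D'.adj) (daggerAdj D.adj) f).symm

/-- Moving `f` around the loop: it leaves the cup as its right transpose and passes the daggered
cup as the 2-morphism whose left transpose is the same. -/
theorem cupTrace_comp_of_mate_eq {f f' : X ⟶ Y} (h : rightMate D D' f = leftMate D D' f')
    (g : Y ⟶ X) : cupTrace D.cup (f ≫ g) = cupTrace D'.cup (g ≫ f') := by
  rw [cupTrace_apply, cupTrace_apply]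
  congr 1
  calc _ = (D.cup ≫ D.dual ◁ f) ≫ D.dual ◁ g ≫ dag D.cup := by simp
    _ = D'.cup ≫ (rightMate D D' f ▷ Y ≫ D.dual ◁ g) ≫ dag D.cup := by rw [cup_comp D D']; simp
    _ = D'.cup ≫ D'.dual ◁ g ≫ leftMate D D' f' ▷ X ≫ dag D.cup := by
      rw [← whisker_exchange, h]; simp
    _ = _ := by rw [← comp_dag_cup]; simp

theorem capTrace_comp_of_mate_eq {f f' : X ⟶ Y} (h : leftMate D D' f = rightMate D D' f')
    (g : Y ⟶ X) : capTrace D.cap (f ≫ g) = capTrace D'.cap (g ≫ f') := by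
  rw [capTrace_apply, capTrace_apply]
  congr 1
  calc _ = (dag D.cap ≫ f ▷ D.dual) ≫ g ▷ D.dual ≫ D.cap := by simp
    _ = dag D'.cap ≫ (Y ◁ leftMate D D' f ≫ g ▷ D.dual) ≫ D.cap := by
      rw [dag_cap_comp D D']; simp
    _ = dag D'.cap ≫ g ▷ D'.dual ≫ X ◁ rightMate D D' f' ≫ D.cap := by
      rw [whisker_exchange, h]; simp
    _ = _ := by rw [← comp_cap]; simp

theorem qdim_eq_cupTrace : D.qdim = (cupTrace D.cup (𝟙 X)).re := by
  rw [qdim, dimL, cupTrace_apply]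
  simp

variable [IsPresemisimple B]

/-- For standard duals the right and left transposes agree. With `θ = leftMate⁻¹ ∘ rightMate`,
equality of the two traces gives `θ = θ⁻¹`, so `v = f - θ f` satisfies `θ v = -v`; but
`Tr (v† v) = Tr (θ(v) v†)`, and both `Tr (v† v)` and `Tr (v v†)` are nonnegative. -/
theorem rightMate_eq_leftMate (f : X ⟶ Y) : rightMate D D' f = leftMate D D' f := by
  obtain ⟨g, hg⟩ := exists_leftMate_eq D D' (rightMate D D' f)
  obtain ⟨g', hg'⟩ := exists_rightMate_eq D D' (leftMate D D' f)
  have hgg : g = g' := by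
    have h1 (k : Y ⟶ X) : cupTrace D'.cup (k ≫ (g - g')) = 0 := by
      have e1 : cupTrace D'.cup (k ≫ g) = cupTrace D'.cup (k ≫ g') := by
        rw [← cupTrace_comp_of_mate_eq D D' hg.symm, cupTrace_eq_capTrace,
          capTrace_comp_of_mate_eq D D' hg'.symm, cupTrace_eq_capTrace]
      rw [comp_sub]
      exact (map_sub (cupTrace D'.cup) (k ≫ g) (k ≫ g')).trans (sub_eq_zero.2 e1)
    obtain ⟨x, -, hx, h0⟩ := cupTrace_comp_dag D'.adj (dag (g - g'))
    rw [dag_dag, h1] at hx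
    have h2 := h0 (by exact_mod_cast hx.symm)
    rw [← sub_eq_zero, ← dag_dag (g - g'), h2, dag_zero]
  subst hgg
  have hv : rightMate D D' (f - g) = leftMate D D' (g - f) := by
    rw [rightMate_sub, leftMate_sub, hg, hg']
  have h1 := cupTrace_comp_of_mate_eq D D' hv (dag (f - g))
  obtain ⟨x, hx, hx', h0⟩ := cupTrace_comp_dag D.adj (f - g)
  obtain ⟨y, hy, hy', -⟩ := cupTrace_comp_dag D'.adj (dag (f - g))
  rw [dag_dag] at hy'
  have h2 : cupTrace D'.cup (dag (f - g) ≫ (g - f)) = -y := by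
    rw [← neg_sub f g, comp_neg, ← hy']
    exact map_neg (cupTrace D'.cup) (dag (f - g) ≫ (f - g))
  rw [hx', h2] at h1
  have h3 : x = -y := by exact_mod_cast h1
  rw [← hg, sub_eq_zero.1 (h0 (by linarith))]

/-- The standard trace is independent of the choice of standard duals, and cyclic. -/
theorem cupTrace_comp_comm (f : X ⟶ Y) (g : Y ⟶ X) :
    cupTrace D.cup (f ≫ g) = cupTrace D'.cup (g ≫ f) :=
  cupTrace_comp_of_mate_eq D D' (rightMate_eq_leftMate D D' f) g

/-- The quantum dimension is monotone under isometries, strictly so unless they are unitary. -/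
theorem qdim_add_eq_of_isometry {i : X ⟶ Y} (hi : IsIsometry i) :
    ∃ x : ℝ, 0 ≤ x ∧ D'.qdim = D.qdim + x ∧ (x = 0 → IsUnitary i) := by
  have hi' : i ≫ dag i = 𝟙 X := hi
  obtain ⟨x, hx, hx', h0⟩ := cupTrace_comp_dag D'.adj (𝟙 Y - dag i ≫ i)
  have h1 : (𝟙 Y - dag i ≫ i) ≫ dag (𝟙 Y - dag i ≫ i) = 𝟙 Y - dag i ≫ i := by
    have : (dag i ≫ i) ≫ dag i ≫ i = dag i ≫ i := by
      rw [Category.assoc, ← Category.assoc i, hi', Category.id_comp]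
    simp only [dag_sub, dag_id, dag_comp, dag_dag, comp_sub, sub_comp, Category.id_comp,
      Category.comp_id, this, sub_self, sub_zero]
  rw [h1] at hx'
  refine ⟨x, hx, ?_, fun h => ⟨hi, (sub_eq_zero.1 (h0 h)).symm⟩⟩
  have h2 : cupTrace D'.cup (𝟙 Y - dag i ≫ i) =
      cupTrace D'.cup (𝟙 Y) - cupTrace D'.cup (dag i ≫ i) :=
    map_sub (cupTrace D'.cup) (𝟙 Y) (dag i ≫ i)
  rw [qdim_eq_cupTrace, qdim_eq_cupTrace, ← hi', cupTrace_comp_comm D D', ← Complex.ofReal_re x,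
    ← hx', ← Complex.add_re]
  congr 1
  exact (add_eq_of_eq_sub' h2).symm

end Mates

/-- Every 1-morphism has a standard dual: rescaling an arbitrary duality by the positive invertible
endomorphism that intertwines its two traces makes it standard. -/
theorem exists_standardDual [IsPresemisimple B] (X : a ⟶ b) : Nonempty (StandardDual X) := by
  obtain ⟨Xd, ⟨adj⟩⟩ := IsPresemisimple.rigid X
  obtain ⟨k, l, hk, hkl, hlk, hφ⟩ :=
    (isPosDefFunctional_cupTrace adj).exists_intertwiner (isPosDefFunctional_capTrace adj)
  let k : X ⟶ X := k
  let l : X ⟶ X := l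
  replace hk : dag k = k := hk
  replace hkl : l ≫ k = 𝟙 X := hkl
  replace hlk : k ≫ l = 𝟙 X := hlk
  have hl : dag l = l := by
    have h1 : dag l ≫ k = 𝟙 X := by rw [← hk, ← dag_comp, hlk, dag_id]
    rw [← Category.comp_id (dag l), ← hlk, ← Category.assoc, h1, Category.id_comp]
  refine ⟨⟨Xd, ⟨adj.unit ≫ Xd ◁ k, l ▷ Xd ≫ adj.counit, ?_, ?_⟩, ?_⟩⟩
  · calc _ = adj.unit ▷ Xd ⊗≫ Xd ◁ (k ≫ l) ▷ Xd ⊗≫ Xd ◁ adj.counit := by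
          dsimp only [leftZigzag]; bicategory
      _ = leftZigzag adj.unit adj.counit := by rw [hlk]; bicategory
      _ = _ := adj.left_triangle
  · calc _ = X ◁ adj.unit ⊗≫ ((X ≫ Xd) ◁ k ≫ (l ▷ Xd ≫ adj.counit) ▷ X) ⊗≫ 𝟙 _ := by
          dsimp only [rightZigzag]; bicategory
      _ = (X ◁ adj.unit ≫ l ▷ (Xd ≫ X)) ⊗≫ adj.counit ▷ X ⊗≫ k ⊗≫ 𝟙 _ := by
          rw [whisker_exchange]; bicategory
      _ = 𝟙 _ ⊗≫ l ⊗≫ rightZigzag adj.unit adj.counit ⊗≫ k ⊗≫ 𝟙 _ := by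
          rw [whisker_exchange]; bicategory
      _ = 𝟙 _ ⊗≫ (l ≫ k) ⊗≫ 𝟙 _ := by rw [adj.right_triangle]; bicategory
      _ = _ := by rw [hkl]; bicategory
  · intro T
    have h := hφ T
    change cupTrace adj.unit (k ≫ T ≫ k) = capTrace adj.counit (l ≫ T ≫ l) at h
    rw [cupTrace_apply, capTrace_apply] at h
    simpa [hk, hl] using h

/-- The dual of `X*` is `X`, with the daggered cup and cap. -/
def symm {X : a ⟶ b} (D : StandardDual X) : StandardDual D.dual where
  dual := X
  adj := daggerAdj D.adj
  standard := by
    intro T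
    obtain ⟨S, rfl⟩ := exists_rightMate_eq D D T
    have h := D.standard S
    rw [daggerAdj_unit, daggerAdj_counit, dag_dag, dag_dag, ← Category.assoc D.adj.unit,
      ← D.cup_comp D, ← D.comp_cap D, Category.assoc]
    exact h.symm

section Comp
variable {c : B} {X : a ⟶ b} {Y : b ⟶ c}

/-- The standard dual of a composite, with nested cups and caps. -/
def comp (D : StandardDual X) (D' : StandardDual Y) : StandardDual (X ≫ Y) where
  dual := D'.dual ≫ D.dual
  adj := D'.adj.comp D.adj
  standard := by
    intro T
    -- `P` and `Q` close the `X`-wire and the `Y`-wire of `T`, respectively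
    let P : Y ⟶ Y := (λ_ Y).inv ≫ D.cup ▷ Y ≫ (α_ _ _ _).hom ≫ D.dual ◁ T ≫
      (α_ _ _ _).inv ≫ dag D.cup ▷ Y ≫ (λ_ Y).hom
    let Q : X ⟶ X := (ρ_ X).inv ≫ X ◁ dag D'.cap ≫ (α_ _ _ _).inv ≫ T ▷ D'.dual ≫
      (α_ _ _ _).hom ≫ X ◁ D'.cap ≫ (ρ_ X).hom
    have e1 : (D'.adj.comp D.adj).unit ≫ (D'.dual ≫ D.dual) ◁ T ≫
        dag (D'.adj.comp D.adj).unit = D'.cup ≫ D'.dual ◁ P ≫ dag D'.cup := by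
      rw [dag_compUnit]
      simp only [P, Bicategory.Adjunction.comp_unit, Bicategory.Adjunction.compUnit]
      bicategory
    have e2 : dag D'.cap ≫ P ▷ D'.dual ≫ D'.cap = D.cup ≫ D.dual ◁ Q ≫ dag D.cup := by
      simp only [P, Q]
      calc
        _ = 𝟙 _ ⊗≫ (𝟙 b ◁ dag D'.cap ≫ D.cup ▷ (Y ≫ D'.dual)) ⊗≫ D.dual ◁ T ▷ D'.dual ⊗≫
              (dag D.cup ▷ (Y ≫ D'.dual) ≫ 𝟙 b ◁ D'.cap) ⊗≫ 𝟙 _ := by bicategory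
        _ = _ := by
          rw [whisker_exchange D.cup, ← whisker_exchange (dag D.cup)]; bicategory
    have e3 : dag (D'.adj.comp D.adj).counit ≫ T ▷ (D'.dual ≫ D.dual) ≫
        (D'.adj.comp D.adj).counit = dag D.cap ≫ Q ▷ D.dual ≫ D.cap := by
      rw [dag_compCounit]
      simp only [Q, Bicategory.Adjunction.comp_counit, Bicategory.Adjunction.compCounit]
      bicategory
    rw [e1, e3, D'.standard P, e2, D.standard Q]

end Comp
end StandardDual

end Duality

section ChoiOperators

variable {B : Type u} [Bicategory.{w, v} B]

/-! ### Scalars and normalisation -/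

section Scalars
variable {a b : B}

/-- The action of a scalar `c ∈ End(id_a)` on `Z : a → b` from the left. -/
def leftScalar (c : 𝟙 a ⟶ 𝟙 a) (Z : a ⟶ b) : Z ⟶ Z := (λ_ Z).inv ≫ c ▷ Z ≫ (λ_ Z).hom

/-- The action of a scalar `c ∈ End(id_b)` on `Z : a → b` from the right. -/
def rightScalar (c : 𝟙 b ⟶ 𝟙 b) (Z : a ⟶ b) : Z ⟶ Z := (ρ_ Z).inv ≫ Z ◁ c ≫ (ρ_ Z).hom

@[simp] theorem leftScalar_id (Z : a ⟶ b) : leftScalar (𝟙 (𝟙 a)) Z = 𝟙 Z := by simp [leftScalar]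
@[simp] theorem rightScalar_id (Z : a ⟶ b) : rightScalar (𝟙 (𝟙 b)) Z = 𝟙 Z := by simp [rightScalar]

theorem leftScalar_comp (c d : 𝟙 a ⟶ 𝟙 a) (Z : a ⟶ b) :
    leftScalar (c ≫ d) Z = leftScalar c Z ≫ leftScalar d Z := by simp [leftScalar]

theorem rightScalar_comp (c d : 𝟙 b ⟶ 𝟙 b) (Z : a ⟶ b) :
    rightScalar (c ≫ d) Z = rightScalar c Z ≫ rightScalar d Z := by simp [rightScalar]

theorem leftScalar_naturality (c : 𝟙 a ⟶ 𝟙 a) {Z W : a ⟶ b} (f : Z ⟶ W) :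
    leftScalar c Z ≫ f = f ≫ leftScalar c W := by
  have h := congrArg (· ≫ (λ_ W).hom) (whisker_exchange c f)
  simp only [id_whiskerLeft, Category.assoc, Iso.inv_hom_id, Category.comp_id] at h
  simp [leftScalar, ← cancel_epi (λ_ Z).hom, h]

theorem rightScalar_naturality (c : 𝟙 b ⟶ 𝟙 b) {Z W : a ⟶ b} (f : Z ⟶ W) :
    rightScalar c Z ≫ f = f ≫ rightScalar c W := by
  have h := congrArg (· ≫ (ρ_ W).hom) (whisker_exchange f c)
  simp only [whiskerRight_id, Category.assoc, Iso.inv_hom_id, Category.comp_id] at h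
  simp [rightScalar, ← cancel_epi (ρ_ Z).hom, ← h]

variable [CStarTwoCategory B]

@[simp] theorem dag_leftScalar (c : 𝟙 a ⟶ 𝟙 a) (Z : a ⟶ b) :
    dag (leftScalar c Z) = leftScalar (dag c) Z := by simp [leftScalar]

@[simp] theorem dag_rightScalar (c : 𝟙 b ⟶ 𝟙 b) (Z : a ⟶ b) :
    dag (rightScalar c Z) = rightScalar (dag c) Z := by simp [rightScalar]

theorem IsPositive.scalars {c : 𝟙 a ⟶ 𝟙 a} {d : 𝟙 b ⟶ 𝟙 b} (hc : IsPositive c)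
    (hd : IsPositive d) {Z : a ⟶ b} {p : Z ⟶ Z} (hp : IsPositive p) :
    IsPositive (leftScalar c Z ≫ p ≫ rightScalar d Z) := by
  obtain ⟨c', rfl⟩ := isPositive_iff_exists_end.1 hc
  obtain ⟨d', rfl⟩ := isPositive_iff_exists_end.1 hd
  have h := (hp.conj (leftScalar c' Z)).conj (rightScalar d' Z)
  rwa [dag_leftScalar, dag_rightScalar, ← leftScalar_naturality, ← Category.assoc,
    rightScalar_naturality, Category.assoc, ← rightScalar_comp, ← Category.assoc (leftScalar c' Z),
    ← leftScalar_comp, Category.assoc] at h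

end Scalars

variable [CStarTwoCategory B]

namespace StandardDual
variable {a b : B} {X : a ⟶ b} (D : StandardDual X)

theorem isPositive_dimL : IsPositive D.dimL := isPositive_comp_dag _

theorem isPositive_n : IsPositive D.n := (posSqrt_spec D.isPositive_dimL).1

theorem n_comp_n : D.n ≫ D.n = D.dimL := (posSqrt_spec D.isPositive_dimL).2

theorem dag_n : dag D.n = D.n := D.isPositive_n.dag_eq

theorem nSqrt_comp_nSqrt : D.nSqrt ≫ D.nSqrt = D.n := (posSqrt_spec D.isPositive_n).2

theorem dag_nSqrt : dag D.nSqrt = D.nSqrt := (posSqrt_spec D.isPositive_n).1.dag_eq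

section Separable
variable {D} (hD : D.IsSeparable)
include hD

theorem IsSeparable.isIso_n : IsIso D.n := isIso_of_comp_self hD D.n_comp_n

theorem IsSeparable.isIso_nSqrt : IsIso D.nSqrt :=
  isIso_of_comp_self hD.isIso_n D.nSqrt_comp_nSqrt

theorem IsSeparable.n_comp_nInv : D.n ≫ D.nInv = 𝟙 _ := comp_inverse hD.isIso_n

theorem IsSeparable.nInv_comp_n : D.nInv ≫ D.n = 𝟙 _ := inverse_comp hD.isIso_n

theorem IsSeparable.dag_nInv : dag D.nInv = D.nInv := dag_inverse hD.isIso_n D.dag_n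

theorem IsSeparable.dag_nInvSqrt : dag D.nInvSqrt = D.nInvSqrt :=
  dag_inverse hD.isIso_nSqrt D.dag_nSqrt

theorem IsSeparable.nSqrt_comp_nInvSqrt : D.nSqrt ≫ D.nInvSqrt = 𝟙 _ :=
  comp_inverse hD.isIso_nSqrt

theorem IsSeparable.nInvSqrt_comp_nSqrt : D.nInvSqrt ≫ D.nSqrt = 𝟙 _ :=
  inverse_comp hD.isIso_nSqrt

theorem IsSeparable.isPositive_nInv : IsPositive D.nInv := by
  have h := D.isPositive_n.conj D.nInv
  rwa [hD.dag_nInv, hD.n_comp_nInv, Category.comp_id] at h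

theorem IsSeparable.nInv_dimL_nInv : D.nInv ≫ D.dimL ≫ D.nInv = 𝟙 _ := by
  rw [← D.n_comp_n, Category.assoc, hD.n_comp_nInv, Category.comp_id, hD.nInv_comp_n]

/-- Whiskering with a separable 1-morphism reflects positivity, since `T` is recovered from
`id_X ⊗ T` by closing the `X`-wire. -/
theorem IsSeparable.isPositive_whiskerLeft_iff {c : B} {Z : b ⟶ c} {T : Z ⟶ Z} :
    IsPositive (X ◁ T) ↔ IsPositive T := by
  refine ⟨fun ⟨W, g, hg⟩ => ?_, fun ⟨W, g, hg⟩ => ⟨X ≫ W, X ◁ g, by rw [hg]; simp⟩⟩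
  have h1 : IsPositive (D.dual ◁ X ◁ T) := ⟨D.dual ≫ W, D.dual ◁ g, by rw [hg]; simp⟩
  have h2 := h1.conj ((λ_ Z).inv ≫ (D.nInv ≫ D.cup) ▷ Z ≫ (α_ _ _ _).hom)
  have h3 : ((λ_ Z).inv ≫ (D.nInv ≫ D.cup) ▷ Z ≫ (α_ _ _ _).hom) ≫ D.dual ◁ X ◁ T ≫
      dag ((λ_ Z).inv ≫ (D.nInv ≫ D.cup) ▷ Z ≫ (α_ _ _ _).hom) = T := by
    simp only [dag_comp, dag_associator_hom, dag_whiskerRight, dag_leftUnitor_inv, hD.dag_nInv]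
    calc _ = 𝟙 _ ⊗≫ ((D.nInv ≫ D.cup) ▷ Z ≫ (D.dual ≫ X) ◁ T) ⊗≫
            (dag D.cup ≫ D.nInv) ▷ Z ⊗≫ 𝟙 _ := by bicategory
      _ = T ⊗≫ (D.nInv ≫ D.dimL ≫ D.nInv) ▷ Z ⊗≫ 𝟙 _ := by
        rw [← whisker_exchange, dimL]; bicategory
      _ = T := by rw [hD.nInv_dimL_nInv]; bicategory
  rwa [h3] at h2

theorem IsSeparable.isPositive_whiskerRight_iff {c : B} {Z : c ⟶ b} {T : Z ⟶ Z} :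
    IsPositive (T ▷ D.dual) ↔ IsPositive T := by
  refine ⟨fun ⟨W, g, hg⟩ => ?_, fun ⟨W, g, hg⟩ => ⟨W ≫ D.dual, g ▷ D.dual, by rw [hg]; simp⟩⟩
  have h1 : IsPositive (T ▷ D.dual ▷ X) := ⟨W ≫ X, g ▷ X, by rw [hg]; simp⟩
  have h2 := h1.conj ((ρ_ Z).inv ≫ Z ◁ (D.nInv ≫ D.cup) ≫ (α_ _ _ _).inv)
  have h3 : ((ρ_ Z).inv ≫ Z ◁ (D.nInv ≫ D.cup) ≫ (α_ _ _ _).inv) ≫ T ▷ D.dual ▷ X ≫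
      dag ((ρ_ Z).inv ≫ Z ◁ (D.nInv ≫ D.cup) ≫ (α_ _ _ _).inv) = T := by
    simp only [dag_comp, dag_associator_inv, dag_whiskerLeft, dag_rightUnitor_inv, hD.dag_nInv]
    calc _ = 𝟙 _ ⊗≫ (Z ◁ (D.nInv ≫ D.cup) ≫ T ▷ (D.dual ≫ X)) ⊗≫
            Z ◁ (dag D.cup ≫ D.nInv) ⊗≫ 𝟙 _ := by bicategory
      _ = T ⊗≫ Z ◁ (D.nInv ≫ D.dimL ≫ D.nInv) ⊗≫ 𝟙 _ := by
        rw [whisker_exchange, dimL]; bicategory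
      _ = T := by rw [hD.nInv_dimL_nInv]; bicategory
  rwa [h3] at h2

end Separable

/-- Transposition with respect to a standard duality is a `*`-anti-isomorphism, as right and left
transposes agree; hence it preserves and reflects positivity. -/
theorem isPositive_leftMate_iff [IsPresemisimple B] {T : X ⟶ X} :
    IsPositive (D.leftMate D T) ↔ IsPositive T := by
  have hdag (h : X ⟶ X) : dag (D.leftMate D h) = D.leftMate D (dag h) := by
    rw [← D.rightMate_eq_leftMate D, D.dag_rightMate]
  have hcomp (g h : X ⟶ X) : D.leftMate D h ≫ D.leftMate D g = D.leftMate D (g ≫ h) :=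
    conjugateEquiv_comp _ _ _ _ _
  rw [isPositive_iff_exists_end, isPositive_iff_exists_end]
  constructor
  · rintro ⟨g, hg⟩
    obtain ⟨h, rfl⟩ := D.exists_leftMate_eq D g
    rw [hdag, hcomp] at hg
    exact ⟨dag h, by rw [dag_dag]; exact (Bicategory.conjugateEquiv _ _).injective hg⟩
  · rintro ⟨g, rfl⟩
    exact ⟨D.leftMate D (dag g), by rw [hdag, hcomp, dag_dag]⟩

end StandardDual

/-! ### Positivity of the Choi operators -/

section Choi
variable {r s t : B} {X : r ⟶ s} {Y : r ⟶ t} (DX : StandardDual X) (DY : StandardDual Y)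

/-- The operator `X* ⊗ Y → X* ⊗ Y` obtained from `f : X ⊗ X* → Y ⊗ Y*` by bending the first input
and the last output. -/
def outerChoi (f : X ≫ DX.dual ⟶ Y ≫ DY.dual) : DX.dual ≫ Y ⟶ DX.dual ≫ Y :=
  𝟙 _ ⊗≫ DX.cup ▷ (DX.dual ≫ Y) ⊗≫ DX.dual ◁ f ▷ Y ⊗≫ (DX.dual ≫ Y) ◁ dag DY.cup ⊗≫ 𝟙 _

/-- The operator `Y* ⊗ X → Y* ⊗ X` obtained from `f : X ⊗ X* → Y ⊗ Y*` by bending the last input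
and the first output. -/
def innerChoi (f : X ≫ DX.dual ⟶ Y ≫ DY.dual) : DY.dual ≫ X ⟶ DY.dual ≫ X :=
  bend DY (DX.adj.homEquiv₂ f ≫ (α_ _ _ _).hom)

/-- The CP condition with the coherence isomorphisms written out. -/
theorem AlgData.isCP_iff (A A' : AlgData r) (f : A.obj ⟶ A'.obj) : AlgData.IsCP A A' f ↔
    IsPositive (dag A.mul ▷ A'.obj ≫ (α_ _ _ _).hom ≫ A.obj ◁ f ▷ A'.obj ≫ A.obj ◁ A'.mul) := by
  have h : dag A.mul ▷ A'.obj ⊗≫ A.obj ◁ f ▷ A'.obj ⊗≫ A.obj ◁ A'.mul =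
      dag A.mul ▷ A'.obj ≫ (α_ _ _ _).hom ≫ A.obj ◁ f ▷ A'.obj ≫ A.obj ◁ A'.mul := by
    simp [bicategoricalComp]
  rw [← h]
  rfl

/-- The 2-morphism in the CP condition is `id_X ⊗ T ⊗ id_{Y*}`, where `T` is the outer Choi
operator multiplied by the positive invertible scalars `n_X⁻¹` and `n_Y⁻¹`. -/
theorem isCP_iff_isPositive_outerChoi (hX : DX.IsSeparable) (hY : DY.IsSeparable)
    (f : X ≫ DX.dual ⟶ Y ≫ DY.dual) :
    AlgData.IsCP DX.pairOfPants DY.pairOfPants f ↔ IsPositive (outerChoi DX DY f) := by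
  have h1 : dag DX.pairOfPants.mul ▷ (Y ≫ DY.dual) ≫ (α_ _ _ _).hom ≫
      (X ≫ DX.dual) ◁ f ▷ (Y ≫ DY.dual) ≫ (X ≫ DX.dual) ◁ DY.pairOfPants.mul =
      ((α_ _ _ _).hom ≫ X ◁ (α_ _ _ _).inv) ≫ X ◁ ((leftScalar DX.nInv _ ≫ outerChoi DX DY f ≫
        rightScalar DY.nInv _) ▷ DY.dual) ≫ dag ((α_ _ _ _).hom ≫ X ◁ (α_ _ _ _).inv) := by
    have h2 : dag DX.pairOfPants.mul = 𝟙 _ ⊗≫ X ◁ (DX.nInv ≫ DX.cup) ▷ DX.dual ⊗≫ 𝟙 _ := by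
      simp [bicategoricalComp, hX.dag_nInv]
    rw [h2, leftScalar, rightScalar, outerChoi]
    simp only [dag_comp, dag_whiskerLeft, dag_associator_hom, dag_associator_inv]
    bicategory
  have h3 : AlgData.IsCP DX.pairOfPants DY.pairOfPants f ↔
      IsPositive (X ◁ ((leftScalar DX.nInv _ ≫ outerChoi DX DY f ≫
        rightScalar DY.nInv _) ▷ DY.dual)) := by
    refine (AlgData.isCP_iff _ _ _).trans ((iff_of_eq (congrArg IsPositive h1)).trans ?_)
    refine ⟨fun h => ?_, fun h => h.conj _⟩
    have h4 := h.conj (dag ((α_ X DX.dual (Y ≫ DY.dual)).hom ≫ X ◁ (α_ _ _ _).inv))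
    simpa using h4
  rw [h3, hX.isPositive_whiskerLeft_iff, hY.isPositive_whiskerRight_iff]
  refine ⟨fun h => ?_, fun h => hX.isPositive_nInv.scalars hY.isPositive_nInv h⟩
  have h4 := DX.isPositive_n.scalars DY.isPositive_n h
  simp only [Category.assoc, ← rightScalar_comp] at h4
  rw [← Category.assoc, ← leftScalar_comp, hX.n_comp_nInv, hY.nInv_comp_n] at h4
  simpa using h4

/-- The two Choi operators are transposes of each other. -/
theorem leftMate_outerChoi (f : X ≫ DX.dual ⟶ Y ≫ DY.dual) :
    Bicategory.conjugateEquiv (daggerAdj (DY.adj.comp (daggerAdj DX.adj)))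
      (daggerAdj (DY.adj.comp (daggerAdj DX.adj))) (outerChoi DX DY f) = innerChoi DX DY f := by
  rw [conjugateEquiv_apply', daggerAdj_unit, daggerAdj_counit, dag_compUnit, dag_compCounit,
    outerChoi, innerChoi, bend, Adjunction.homEquiv₂_apply, daggerAdj_unit, daggerAdj_counit,
    dag_dag, dag_dag]
  calc
    -- straighten the `X`-wire, then the `Y`-wire
    _ = 𝟙 _ ⊗≫ (DY.dual ≫ X) ◁ DX.cup ⊗≫
          (DY.dual ≫ X ≫ DX.dual) ◁ dag DY.cap ▷ X ⊗≫
          DY.dual ◁ X ◁ DX.cup ▷ (DX.dual ≫ Y ≫ DY.dual ≫ X) ⊗≫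
          DY.dual ◁ ((X ≫ DX.dual) ◁ (f ▷ Y ⊗≫ Y ◁ dag DY.cup ⊗≫ 𝟙 Y) ≫ DX.cap ▷ Y) ▷
            (DY.dual ≫ X) ⊗≫ dag DY.cup ▷ (DY.dual ≫ X) ⊗≫ 𝟙 _ := by
      bicategory
    _ = 𝟙 _ ⊗≫ (DY.dual ≫ X) ◁ DX.cup ⊗≫
          (DY.dual ≫ X ≫ DX.dual) ◁ dag DY.cap ▷ X ⊗≫
          DY.dual ◁ rightZigzag DX.adj.unit DX.adj.counit ▷ (DX.dual ≫ Y ≫ DY.dual ≫ X) ⊗≫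
          DY.dual ◁ (f ▷ Y ⊗≫ Y ◁ dag DY.cup ⊗≫ 𝟙 Y) ▷
            (DY.dual ≫ X) ⊗≫ dag DY.cup ▷ (DY.dual ≫ X) ⊗≫ 𝟙 _ := by
      rw [whisker_exchange]; bicategory
    _ = 𝟙 _ ⊗≫ (DY.dual ≫ X) ◁ DX.cup ⊗≫
          DY.dual ◁ ((X ≫ DX.dual) ◁ dag DY.cap ≫ f ▷ (Y ≫ DY.dual)) ▷ X ⊗≫
          (DY.dual ≫ Y) ◁ dag DY.cup ▷ (DY.dual ≫ X) ⊗≫ dag DY.cup ▷ (DY.dual ≫ X) ⊗≫ 𝟙 _ := by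
      rw [DX.adj.right_triangle]; bicategory
    _ = 𝟙 _ ⊗≫ (DY.dual ≫ X) ◁ DX.cup ⊗≫ DY.dual ◁ f ▷ X ⊗≫
          DY.dual ◁ Y ◁ rightZigzag (daggerAdj DY.adj).unit (daggerAdj DY.adj).counit ▷ X ⊗≫
          dag DY.cup ▷ (DY.dual ≫ X) ⊗≫ 𝟙 _ := by
      rw [whisker_exchange, daggerAdj_unit, daggerAdj_counit]; bicategory
    _ = _ := by
      rw [(daggerAdj DY.adj).right_triangle]; bicategory

theorem isCP_iff_isPositive_innerChoi [IsPresemisimple B] (hX : DX.IsSeparable)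
    (hY : DY.IsSeparable) (f : X ≫ DX.dual ⟶ Y ≫ DY.dual) :
    AlgData.IsCP DX.pairOfPants DY.pairOfPants f ↔ IsPositive (innerChoi DX DY f) := by
  rw [isCP_iff_isPositive_outerChoi DX DY hX hY, ← leftMate_outerChoi]
  exact (DX.symm.comp DY).isPositive_leftMate_iff.symm

end Choi

end ChoiOperators

section Dilations

variable {B : Type u} [Bicategory.{w, v} B] [CStarTwoCategory B]

/-! ### Dilations as factorisations of the Choi operator -/

section Dilation
variable {r s t : B} {X : r ⟶ s} {Y : r ⟶ t} {E E' : t ⟶ s}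

theorem bend_eq_homEquiv₁ (DY : StandardDual Y) (τ : X ⟶ Y ≫ E) :
    bend DY τ = (daggerAdj DY.adj).homEquiv₁ τ := by
  rw [bend, Adjunction.homEquiv₁_apply, daggerAdj_counit]
  bicategory

theorem bend_injective (DY : StandardDual Y) :
    Function.Injective (bend DY : (X ⟶ Y ≫ E) → (DY.dual ≫ X ⟶ E)) := fun σ τ h => by
  rw [bend_eq_homEquiv₁, bend_eq_homEquiv₁] at h
  exact (Equiv.injective _) h

theorem bend_surjective (DY : StandardDual Y) (g : DY.dual ≫ X ⟶ E) :
    ∃ τ : X ⟶ Y ≫ E, bend DY τ = g := by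
  obtain ⟨τ, hτ⟩ := (daggerAdj DY.adj).homEquiv₁.surjective g
  exact ⟨τ, by rw [bend_eq_homEquiv₁, hτ]⟩

theorem bend_comp_whiskerLeft (DY : StandardDual Y) (τ : X ⟶ Y ≫ E) (g : E ⟶ E') :
    bend DY (τ ≫ Y ◁ g) = bend DY τ ≫ g := by
  calc bend DY (τ ≫ Y ◁ g) = DY.dual ◁ τ ⊗≫ ((DY.dual ≫ Y) ◁ g ≫ dag DY.cup ▷ E') ⊗≫ 𝟙 _ := by
        rw [bend]; bicategory
    _ = _ := by rw [whisker_exchange, bend]; bicategory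

variable (DX : StandardDual X) (DY : StandardDual Y) (DE : StandardDual E)

/-- Bending the last input of a dilation map turns the conjugate of `τ` into `dag (bend DY τ)`, and
the zigzag in the environment wire straightens. -/
theorem homEquiv₂_dilationMap (τ : X ⟶ Y ≫ E) :
    DX.adj.homEquiv₂ (dilationMap DX DY DE τ) ≫ (α_ _ _ _).hom = τ ≫ Y ◁ dag (bend DY τ) := by
  have h1 : DX.cup ≫ conj DX DY DE τ ▷ X =
      (DE.adj.comp DY.adj).unit ≫ (DE.dual ≫ DY.dual) ◁ dag τ :=
    (unit_comp_whiskerLeft (DE.adj.comp DY.adj) DX.adj (dag τ)).symm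
  have h2 : dag (bend DY τ) = 𝟙 _ ⊗≫ (DY.cup ▷ E ⊗≫ DY.dual ◁ dag τ) := by
    simp [bend, bicategoricalComp]
  rw [Adjunction.homEquiv₂_apply, dilationMap, h2]
  calc
    _ = 𝟙 _ ⊗≫ (X ◁ DX.cup ≫ τ ▷ (DX.dual ≫ X)) ⊗≫ (Y ≫ E) ◁ conj DX DY DE τ ▷ X ⊗≫
          Y ◁ DE.cap ▷ (DY.dual ≫ X) ⊗≫ 𝟙 _ := by bicategory
    _ = τ ⊗≫ (Y ≫ E) ◁ (DX.cup ≫ conj DX DY DE τ ▷ X) ⊗≫ Y ◁ DE.cap ▷ (DY.dual ≫ X) ⊗≫ 𝟙 _ := by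
      rw [whisker_exchange]; bicategory
    _ = τ ⊗≫ Y ◁ E ◁ DE.cup ⊗≫ Y ◁ ((E ≫ DE.dual) ◁ (DY.cup ▷ E ⊗≫ DY.dual ◁ dag τ) ≫
          DE.cap ▷ (DY.dual ≫ X)) ⊗≫ 𝟙 _ := by
      rw [h1, Bicategory.Adjunction.comp_unit, Bicategory.Adjunction.compUnit]; bicategory
    _ = τ ⊗≫ Y ◁ rightZigzag DE.adj.unit DE.adj.counit ⊗≫
          Y ◁ (DY.cup ▷ E ⊗≫ DY.dual ◁ dag τ) ⊗≫ 𝟙 _ := by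
      rw [whisker_exchange]; bicategory
    _ = _ := by rw [DE.adj.right_triangle]; bicategory

/-- `τ` dilates `f` exactly when `bend DY τ` factorises the Choi operator of `f`. -/
theorem isDilation_iff (τ : X ⟶ Y ≫ E) (f : X ≫ DX.dual ⟶ Y ≫ DY.dual) :
    IsDilation DX DY DE τ f ↔ innerChoi DX DY f = bend DY τ ≫ dag (bend DY τ) := by
  have h : innerChoi DX DY (dilationMap DX DY DE τ) = bend DY τ ≫ dag (bend DY τ) := by
    rw [innerChoi, homEquiv₂_dilationMap, bend_comp_whiskerLeft]
  rw [← h, IsDilation]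
  refine ⟨fun hf => by rw [hf], fun hf => ?_⟩
  have h1 := bend_injective DY hf
  rw [cancel_mono] at h1
  exact (Equiv.injective _) h1

/-! ### Channels -/

theorem dilationMap_comp_dag_one (τ : X ⟶ Y ≫ E) :
    dilationMap DX DY DE τ ≫ dag DY.pairOfPants.one =
      (τ ≫ Y ◁ leftScalar DY.n E ≫ dag τ) ▷ DX.dual ≫ DX.cap := by
  have h1 : (Y ≫ E) ◁ conj DX DY DE τ ≫ (DE.adj.comp DY.adj).counit =
      dag τ ▷ DX.dual ≫ DX.cap :=
    (whiskerRight_comp_counit (DE.adj.comp DY.adj) DX.adj (dag τ)).symm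
  have h2 : dag DY.pairOfPants.one = 𝟙 _ ⊗≫ Y ◁ DY.n ▷ DY.dual ⊗≫ DY.cap := by
    simp [bicategoricalComp, DY.dag_n]
  rw [h2, dilationMap]
  calc
    _ = τ ▷ DX.dual ≫ (Y ≫ E) ◁ conj DX DY DE τ ⊗≫
          Y ◁ (𝟙 t ◁ DE.cap ≫ DY.n ▷ 𝟙 t) ▷ DY.dual ⊗≫ DY.cap := by bicategory
    _ = τ ▷ DX.dual ⊗≫ ((Y ≫ E) ◁ conj DX DY DE τ ≫
          (Y ◁ leftScalar DY.n E) ▷ (DE.dual ≫ DY.dual)) ⊗≫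
          Y ◁ DE.cap ▷ DY.dual ⊗≫ DY.cap := by
      rw [whisker_exchange, leftScalar]; bicategory
    _ = τ ▷ DX.dual ⊗≫ (Y ◁ leftScalar DY.n E) ▷ DX.dual ⊗≫
          ((Y ≫ E) ◁ conj DX DY DE τ ≫ (DE.adj.comp DY.adj).counit) := by
      rw [whisker_exchange, Bicategory.Adjunction.comp_counit, Bicategory.Adjunction.compCounit]
      bicategory
    _ = _ := by rw [h1]; bicategory

theorem dag_one_pairOfPants :
    dag DX.pairOfPants.one = rightScalar DX.n X ▷ DX.dual ≫ DX.cap := by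
  simp [bicategoricalComp, DX.dag_n, rightScalar]

theorem whiskerRight_comp_cap_injective {f g : X ⟶ X}
    (h : f ▷ DX.dual ≫ DX.cap = g ▷ DX.dual ≫ DX.cap) : f = g := by
  have h1 : DX.adj.homEquiv₂.symm (f ≫ (λ_ X).inv) = DX.adj.homEquiv₂.symm (g ≫ (λ_ X).inv) := by
    rw [Adjunction.homEquiv₂_symm_apply, Adjunction.homEquiv₂_symm_apply]
    calc _ = f ▷ DX.dual ≫ DX.cap := by bicategory
      _ = g ▷ DX.dual ≫ DX.cap := h
      _ = _ := by bicategory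
  exact (cancel_mono _).1 (DX.adj.homEquiv₂.symm.injective h1)

theorem normalised_eq (τ : X ⟶ Y ≫ E) :
    normalised DX DY τ = rightScalar DX.nInvSqrt X ≫ τ ≫ Y ◁ leftScalar DY.nSqrt E := by
  rw [normalised, rightScalar, leftScalar]
  bicategory

/-- Both sides say that `τ† ∘ (id_Y ⊗ n_Y ⊗ id_E) ∘ τ = id_X ⊗ n_X`. -/
theorem isIsometry_normalised_iff (hX : DX.IsSeparable) (τ : X ⟶ Y ≫ E) :
    IsIsometry (normalised DX DY τ) ↔
      dilationMap DX DY DE τ ≫ dag DY.pairOfPants.one = dag DX.pairOfPants.one := by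
  have h1 : normalised DX DY τ ≫ dag (normalised DX DY τ) = rightScalar DX.nInvSqrt X ≫
      (τ ≫ Y ◁ leftScalar DY.n E ≫ dag τ) ≫ rightScalar DX.nInvSqrt X := by
    rw [normalised_eq, ← DY.nSqrt_comp_nSqrt, leftScalar_comp]
    simp [DY.dag_nSqrt, hX.dag_nInvSqrt]
  have h2 : rightScalar DX.nSqrt X ≫ rightScalar DX.nInvSqrt X = 𝟙 X := by
    rw [← rightScalar_comp, hX.nSqrt_comp_nInvSqrt, rightScalar_id]
  have h3 : rightScalar DX.nInvSqrt X ≫ rightScalar DX.nSqrt X = 𝟙 X := by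
    rw [← rightScalar_comp, hX.nInvSqrt_comp_nSqrt, rightScalar_id]
  have h4 : rightScalar DX.n X = rightScalar DX.nSqrt X ≫ rightScalar DX.nSqrt X := by
    rw [← rightScalar_comp, DX.nSqrt_comp_nSqrt]
  rw [IsIsometry, h1, dilationMap_comp_dag_one, dag_one_pairOfPants]
  constructor
  · intro h
    have h5 := congrArg (fun x => rightScalar DX.nSqrt X ≫ x ≫ rightScalar DX.nSqrt X) h
    simp only [Category.assoc, h3, Category.comp_id, Category.id_comp] at h5
    rw [← Category.assoc (rightScalar DX.nSqrt X) (rightScalar DX.nInvSqrt X), h2,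
      Category.id_comp, ← h4] at h5
    rw [h5]
  · intro h
    rw [whiskerRight_comp_cap_injective DX h, h4, Category.assoc, h2, Category.comp_id, h3]

end Dilation

/-! ### Minimal dilations -/

section Minimal
theorem absVal_spec {a b : B} {V W : a ⟶ b} (g : V ⟶ W) :
    dag (absVal g) = absVal g ∧ absVal g ≫ absVal g = g ≫ dag g :=
  have h := posSqrt_spec (isPositive_comp_dag g)
  ⟨h.1.dag_eq, h.2⟩

variable {r s t : B} {X : r ⟶ s} {Y : r ⟶ t} {E E₁ E₂ : t ⟶ s}
  (DX : StandardDual X) (DY : StandardDual Y)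
  {f : X ≫ DX.dual ⟶ Y ≫ DY.dual}

theorem exists_dilation (hf : IsPositive (innerChoi DX DY f)) :
    ∃ (E : t ⟶ s) (τ : X ⟶ Y ≫ E), ∀ DE : StandardDual E, IsDilation DX DY DE τ f := by
  obtain ⟨E, g, hg⟩ := hf
  obtain ⟨τ, rfl⟩ := bend_surjective DY g
  exact ⟨E, τ, fun DE => (isDilation_iff DX DY DE τ f).2 hg⟩

/-- Compressing a dilation by a projection that fixes it gives another dilation. -/
theorem IsDilation.compress {DE : StandardDual E} {τ : X ⟶ Y ≫ E} (h : IsDilation DX DY DE τ f)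
    {E₀ : t ⟶ s} (DE₀ : StandardDual E₀) {i : E₀ ⟶ E}
    (hi : bend DY τ ≫ dag i ≫ i = bend DY τ) :
    IsDilation DX DY DE₀ (τ ≫ Y ◁ dag i) f := by
  rw [isDilation_iff] at h ⊢
  rw [h, bend_comp_whiskerLeft, dag_comp, dag_dag]
  simp only [Category.assoc]
  rw [← Category.assoc (dag i), ← Category.assoc (bend DY τ), hi]

variable [IsPresemisimple B]

/-- Two dilations factorise the same Choi operator, so the polar decomposition relates them. -/
theorem IsDilation.exists_partialIsometry {DE₁ : StandardDual E₁} {DE₂ : StandardDual E₂}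
    {τ₁ : X ⟶ Y ≫ E₁} {τ₂ : X ⟶ Y ≫ E₂} (h₁ : IsDilation DX DY DE₁ τ₁ f)
    (h₂ : IsDilation DX DY DE₂ τ₂ f) :
    ∃ α : E₁ ⟶ E₂, IsPartialIsometry α ∧ IsPartialIsometry (dag α) ∧ τ₁ ≫ Y ◁ α = τ₂ ∧
      τ₂ ≫ Y ◁ dag α = τ₁ := by
  rw [isDilation_iff] at h₁ h₂
  obtain ⟨α, hα, hα', h12, h21⟩ := CovStinespring.exists_partialIsometry (h₁.symm.trans h₂)
  exact ⟨α, hα, hα', bend_injective DY (by rw [bend_comp_whiskerLeft, h12]),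
    bend_injective DY (by rw [bend_comp_whiskerLeft, h21])⟩

/-- A projection that fixes a minimal dilation is the identity: otherwise its
range would be a smaller environment. -/
theorem IsMinimalDilation.comp_dag_eq_id {DE : StandardDual E} {τ : X ⟶ Y ≫ E}
    (h : IsMinimalDilation DX DY DE τ f) {p : E ⟶ E} (hp : IsDaggerIdempotent p)
    (hτ : τ ≫ Y ◁ p = τ) : p = 𝟙 E := by
  obtain ⟨E₀, i, hi, rfl⟩ := IsPresemisimple.idempotents_split p hp
  obtain ⟨DE₀⟩ := StandardDual.exists_standardDual E₀
  have h0 := h.2 E₀ DE₀ (τ ≫ Y ◁ dag i) (h.1.compress DX DY DE₀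
    (by rw [← bend_comp_whiskerLeft, hτ]))
  obtain ⟨x, hx, hx', hu⟩ := DE₀.qdim_add_eq_of_isometry DE hi
  exact (hu (by linarith)).2

theorem IsMinimalDilation.exists_unitary {DE₁ : StandardDual E₁} {DE₂ : StandardDual E₂}
    {τ₁ : X ⟶ Y ≫ E₁} {τ₂ : X ⟶ Y ≫ E₂} (h₁ : IsMinimalDilation DX DY DE₁ τ₁ f)
    (h₂ : IsMinimalDilation DX DY DE₂ τ₂ f) :
    ∃ α : E₁ ⟶ E₂, IsUnitary α ∧ τ₁ ≫ Y ◁ α = τ₂ ∧ τ₂ ≫ Y ◁ dag α = τ₁ := by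
  obtain ⟨α, hα, hα', h12, h21⟩ := h₁.1.exists_partialIsometry DX DY h₂.1
  refine ⟨α, ⟨?_, ?_⟩, h12, h21⟩
  · refine h₁.comp_dag_eq_id DX DY ⟨by simp, hα⟩ ?_
    rw [Bicategory.whiskerLeft_comp, ← Category.assoc, h12, h21]
  · refine h₂.comp_dag_eq_id DX DY ⟨by simp, by simpa [IsPartialIsometry] using hα'⟩ ?_
    rw [Bicategory.whiskerLeft_comp, ← Category.assoc, h21, h12]

/-- Compressing with the support of `|τ̃†|` gives a minimal dilation: the compressed operator
cancels on the left, so the partial isometry to any other dilation is an isometry. -/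
theorem IsDilation.isMinimalDilation_compress {DE : StandardDual E} {τ : X ⟶ Y ≫ E}
    (h : IsDilation DX DY DE τ f) {E₀ : t ⟶ s} (DE₀ : StandardDual E₀) {i : E₀ ⟶ E}
    (hi : IsIsometry i) (hs : IsSupport (absVal (dag (bend DY τ))) (dag i ≫ i)) :
    IsMinimalDilation DX DY DE₀ (τ ≫ Y ◁ dag i) f := by
  obtain ⟨hA, hAA⟩ := absVal_spec (dag (bend DY τ))
  rw [dag_dag] at hAA
  set A := absVal (dag (bend DY τ))
  have hfix : bend DY τ ≫ dag i ≫ i = bend DY τ := by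
    have h1 : (dag i ≫ i) ≫ dag (bend DY τ) ≫ dag (dag (bend DY τ)) =
        𝟙 _ ≫ dag (bend DY τ) ≫ dag (dag (bend DY τ)) := by
      rw [dag_dag, ← hAA, Category.id_comp, ← Category.assoc, hs.1.2.1]
    have h2 := congrArg dag (comp_left_cancel_of_comp_dag h1)
    simpa using h2
  have hd := h.compress DX DY DE₀ hfix
  have hcancel {W : t ⟶ s} (x : E₀ ⟶ W) (hx : bend DY τ ≫ dag i ≫ x = 0) : x = 0 := by
    have h1 : A ≫ dag i ≫ x = 0 := by
      rw [← dag_comp_eq_zero, dag_comp, hA]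
      simp only [Category.assoc]
      rw [← Category.assoc A, hAA]
      simp only [Category.assoc, hx, comp_zero]
    have h2 := hs.comp_eq_zero hA h1
    have h3 : i ≫ dag i = 𝟙 E₀ := hi
    have h4 := congrArg (i ≫ ·) h2
    simpa only [Category.assoc, reassoc_of% h3, comp_zero] using h4
  refine ⟨hd, fun E' DE' τ' h' => ?_⟩
  obtain ⟨α, -, -, h12, h21⟩ := hd.exists_partialIsometry DX DY h'
  have h3 : bend DY τ ≫ dag i ≫ (α ≫ dag α - 𝟙 E₀) = 0 := by
    rw [← Category.assoc, ← bend_comp_whiskerLeft, comp_sub, Category.comp_id, ← Category.assoc,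
      ← bend_comp_whiskerLeft, h12, ← bend_comp_whiskerLeft, h21, sub_self]
  have hα : IsIsometry α := sub_eq_zero.1 (hcancel _ h3)
  obtain ⟨x, hx, hx', -⟩ := DE₀.qdim_add_eq_of_isometry DE' hα
  linarith

theorem exists_isSupport_absVal (τ : X ⟶ Y ≫ E) : ∃ (E₀ : t ⟶ s) (i : E₀ ⟶ E), IsIsometry i ∧
    IsSupport (absVal (dag (bend DY τ))) (dag i ≫ i) := by
  obtain ⟨e, he⟩ := exists_isSupport (absVal_spec (dag (bend DY τ))).1
  obtain ⟨E₀, i, hi, rfl⟩ := IsPresemisimple.idempotents_split e he.1.1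
  exact ⟨E₀, i, hi, he⟩

end Minimal

end Dilations

end CovStinespring

end

theorem theorem4 {B : Type u} [Bicategory.{w, v} B] [CStarTwoCategory B] [IsSemisimple B]
    {r s t : B} (X : r ⟶ s) (Y : r ⟶ t) (DX : StandardDual X) (DY : StandardDual Y)
    (hX : DX.IsSeparable) (hY : DY.IsSeparable) :
    -- every CP morphism has a dilation
    (∀ f : X ≫ DX.dual ⟶ Y ≫ DY.dual, AlgData.IsCP DX.pairOfPants DY.pairOfPants f →
      ∃ (E : t ⟶ s) (τ : X ⟶ Y ≫ E), Nonempty (StandardDual E) ∧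
        ∀ DE : StandardDual E, IsDilation DX DY DE τ f) ∧
    -- the normalised dilation of a CP morphism is an isometry iff the morphism is a channel
    (∀ f : X ≫ DX.dual ⟶ Y ≫ DY.dual, AlgData.IsCP DX.pairOfPants DY.pairOfPants f →
      ∀ (E : t ⟶ s) (DE : StandardDual E) (τ : X ⟶ Y ≫ E), IsDilation DX DY DE τ f →
        (IsIsometry (normalised DX DY τ) ↔
          AlgData.IsChannel DX.pairOfPants DY.pairOfPants f)) ∧
    -- conversely every `τ` defines a CP morphism, a channel iff the normalised `τ` is an isometry
    (∀ (E : t ⟶ s) (DE : StandardDual E) (τ : X ⟶ Y ≫ E),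
      AlgData.IsCP DX.pairOfPants DY.pairOfPants (dilationMap DX DY DE τ) ∧
      (AlgData.IsChannel DX.pairOfPants DY.pairOfPants (dilationMap DX DY DE τ) ↔
        IsIsometry (normalised DX DY τ))) ∧
    -- two dilations of a CP morphism are related by a partial isometry on the environment
    (∀ f : X ≫ DX.dual ⟶ Y ≫ DY.dual, AlgData.IsCP DX.pairOfPants DY.pairOfPants f →
      ∀ (E₁ E₂ : t ⟶ s) (DE₁ : StandardDual E₁) (DE₂ : StandardDual E₂)
        (τ₁ : X ⟶ Y ≫ E₁) (τ₂ : X ⟶ Y ≫ E₂),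
        IsDilation DX DY DE₁ τ₁ f → IsDilation DX DY DE₂ τ₂ f →
        ∃ α : E₁ ⟶ E₂, IsPartialIsometry α ∧ τ₁ ≫ Y ◁ α = τ₂ ∧ τ₂ ≫ Y ◁ dag α = τ₁) ∧
    -- a dilation with environment of minimal quantum dimension exists ...
    (∀ f : X ≫ DX.dual ⟶ Y ≫ DY.dual, AlgData.IsCP DX.pairOfPants DY.pairOfPants f →
      ∃ (E : t ⟶ s) (τ : X ⟶ Y ≫ E), Nonempty (StandardDual E) ∧
        ∀ DE : StandardDual E, IsMinimalDilation DX DY DE τ f) ∧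
    -- ... it is unique up to a unitary on the environment ...
    (∀ f : X ≫ DX.dual ⟶ Y ≫ DY.dual, AlgData.IsCP DX.pairOfPants DY.pairOfPants f →
      ∀ (E₁ E₂ : t ⟶ s) (DE₁ : StandardDual E₁) (DE₂ : StandardDual E₂)
        (τ₁ : X ⟶ Y ≫ E₁) (τ₂ : X ⟶ Y ≫ E₂),
        IsMinimalDilation DX DY DE₁ τ₁ f → IsMinimalDilation DX DY DE₂ τ₂ f →
        ∃ α : E₁ ⟶ E₂, IsUnitary α ∧ τ₁ ≫ Y ◁ α = τ₂ ∧ τ₂ ≫ Y ◁ dag α = τ₁) ∧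
    -- ... and it is obtained from any dilation by compressing with the support of `|τ̃†|`
    (∀ f : X ≫ DX.dual ⟶ Y ≫ DY.dual, AlgData.IsCP DX.pairOfPants DY.pairOfPants f →
      ∀ (E : t ⟶ s) (DE : StandardDual E) (τ : X ⟶ Y ≫ E), IsDilation DX DY DE τ f →
        (∃ (E₀ : t ⟶ s) (i : E₀ ⟶ E), IsIsometry i ∧
          IsSupport (absVal (dag (bend DY τ))) (dag i ≫ i)) ∧
        ∀ (E₀ : t ⟶ s) (i : E₀ ⟶ E), IsIsometry i →
          IsSupport (absVal (dag (bend DY τ))) (dag i ≫ i) → Nonempty (StandardDual E₀) ∧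
            ∀ DE₀ : StandardDual E₀, IsMinimalDilation DX DY DE₀ (τ ≫ Y ◁ dag i) f) := by
  have hCP (f : X ≫ DX.dual ⟶ Y ≫ DY.dual) :=
    isCP_iff_isPositive_innerChoi DX DY hX hY f
  have hdil (E : t ⟶ s) (DE : StandardDual E) (τ : X ⟶ Y ≫ E) :
      AlgData.IsCP DX.pairOfPants DY.pairOfPants (dilationMap DX DY DE τ) :=
    (hCP _).2 ⟨E, bend DY τ, (isDilation_iff DX DY DE τ _).1 rfl⟩
  refine ⟨fun f hf => ?_, fun f hf E DE τ hτ => ?_, fun E DE τ => ⟨hdil E DE τ, ?_⟩,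
    fun f _ E₁ E₂ DE₁ DE₂ τ₁ τ₂ h₁ h₂ => ?_, fun f hf => ?_,
    fun f _ E₁ E₂ DE₁ DE₂ τ₁ τ₂ h₁ h₂ => h₁.exists_unitary DX DY h₂,
    fun f _ E DE τ hτ => ⟨exists_isSupport_absVal DY τ, fun E₀ i hi hs =>
      ⟨StandardDual.exists_standardDual E₀,
        fun DE₀ => hτ.isMinimalDilation_compress DX DY DE₀ hi hs⟩⟩⟩
  · obtain ⟨E, τ, h⟩ := exists_dilation DX DY ((hCP f).1 hf)
    exact ⟨E, τ, StandardDual.exists_standardDual E, h⟩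
  · subst hτ
    rw [isIsometry_normalised_iff DX DY DE hX]
    exact ⟨fun h => ⟨hf, h⟩, fun h => h.2⟩
  · rw [isIsometry_normalised_iff DX DY DE hX]
    exact ⟨fun h => h.2, fun h => ⟨hdil E DE τ, h⟩⟩
  · obtain ⟨α, hα, -, h12, h21⟩ := h₁.exists_partialIsometry DX DY h₂
    exact ⟨α, hα, h12, h21⟩
  · obtain ⟨E, τ, h⟩ := exists_dilation DX DY ((hCP f).1 hf)
    obtain ⟨DE⟩ := StandardDual.exists_standardDual E
    obtain ⟨E₀, i, hi, hs⟩ := exists_isSupport_absVal DY τ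
    exact ⟨E₀, τ ≫ Y ◁ dag i, StandardDual.exists_standardDual E₀,
      fun DE₀ => (h DE).isMinimalDilation_compress DX DY DE₀ hi hs⟩
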